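/- **Setting.** Let $\mathcal A$ be a finite action set, $\mathcal Y$ a Euclidean space or a compact subset of one, $\nu$ a measure on $\mathcal Y$, and for each $a\in\mathcal A$ let $Q^*(\cdot|a)$ be a probability measure with positive density $q^*(\cdot|a)$ with respect to $\nu$. Let $u:\mathcal A\times\mathcal Y\to\mathbb R$ satisfy $u(a,\cdot)\in L^1(Q^*(\cdot|a))$. Let $\delta\in[0,1)$ be the discount factor and $\alpha>1$ the switching threshold. A *model* $\theta$ consists of a nonempty finite set $\Omega^\theta\subset\mathbb R^k$ and positive probability densities $q^\theta(\cdot|a,\omega)$ with respect to $\nu$ ($a\in\mathcal A$, $\omega\in\Omega^\theta$) such that $u(a,\cdot)$ is integrable under $q^\theta(\cdot|a,\omega)\,d\nu$ and $|\ln(q^*(\cdot|a)/q^\theta(\cdot|a,\omega))|\le g$ holds $Q^*(\cdot|a)$-a.s. for some $g\in L^2(Q^*(\cdot|a))$. **Behaviour.** For a belief $\pi\in\Delta\Omega^\theta$, let $B^\theta(a,y,\pi)$ be its Bayesian update. An *optimal policy* for $\theta$ is a measurable map $a^\theta:\Delta\Omega^\theta\to\mathcal A$ choosing at each $\pi$ a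 maximizer in $$U^\theta(\pi)=\max_{a}\sum_{\omega}\pi(\omega)\int\big[u(a,y)+\delta U^\theta(B^\theta(a,y,\pi))\big]q^\theta(y|a,\omega)\,\nu(dy),$$ where $U^\theta$ is bounded and measurable. Let $A_m^\theta(\pi)$ be the set of maximizers for $\delta=0$. A switcher with initial model $\theta$ and competing model $\theta^c$, with full-support priors $\pi_0^{\theta},\pi_0^{\theta^c}$ and optimal policies, uses $m_0=\theta$. In each period $t\ge1$, with $l_t^{\vartheta}=\sum_{\omega\in\Omega^{\vartheta}}\pi_0^{\vartheta}(\omega)\prod_{\tau<t}q^{\vartheta}(y_\tau|a_\tau,\omega)$, she switches to the model other than $m_{t-1}$ if its likelihood ratio to $m_{t-1}$, i.e. $l_t^{\vartheta}/l_t^{m_{t-1}}$, exceeds $\alpha$, and otherwise keeps $m_t=m_{t-1}$. She then plays $a_t=a^{m_t}(\pi_t^{m_t})$, where $\pi_t^{m_t}$ is the posterior from the full history, and $y_t$ is drawn from $Q^*(\cdot|a_t)$. Model $\theta$ *persists against* $\theta^c$ (at these priors and policies) if with positive probability $m_t=\theta$ for all large $t$. **Parametric family.** Let $\Omega^q\subseteq\mathbb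 R^k$, and let $q(\cdot|a,\omega)$ ($a\in\mathcal A,\ \omega\in\Omega^q$) be probability densities with respect to $\nu$ such that for each $a$ the distribution with density $q(\cdot|a,\omega)$ depends continuously on $\omega\in\Omega^q$ in the topology of weak convergence. The $q$-family $\Theta^q$ is the set of models $\theta$ with $\Omega^\theta\subseteq\Omega^q$ and $q^\theta(\cdot|a,\omega)=q(\cdot|a,\omega)$ for all $a\in\mathcal A$, $\omega\in\Omega^\theta$. A model $\theta\in\Theta^q$ is *$q$-constrained locally robust* if there exist $\epsilon>0$, a full-support prior $\pi_0^\theta$ and an optimal policy $a^\theta$ under which $\theta$ persists against every $\theta^c\in\Theta^q$ with Hausdorff distance $d_H(\Omega^\theta,\Omega^{\theta^c})\le\epsilon$, at every full-support prior $\pi_0^{\theta^c}$ within Prokhorov distance $\epsilon$ of $\pi_0^\theta$ and every optimal policy $a^{\theta^c}$. **Equilibrium.** For $\sigma\in\Delta\mathcal A$, let $\Omega^\theta(\sigma)$ be the set of minimizers over $\omega\in\Omega^\theta$ of $\sum_a\sigma(a)\int q^*(y|a)\ln\frac{q^*(y|a)}{q^\theta(y|a,\omega)}\nu(dy)$. The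 strategy $\sigma$ is a *Berk–Nash equilibrium* under $\theta$ if $\operatorname{supp}\sigma\subseteq A_m^\theta(\pi)$ for some $\pi\in\Delta\Omega^\theta(\sigma)$; it is *uniformly strict* if moreover $\sigma$ is pure and $\operatorname{supp}\sigma=A_m^\theta(\pi)$ for every $\pi\in\Delta\Omega^\theta(\sigma)$. Model $\theta\in\Theta^q$ is *locally dominant* at $\sigma$ with respect to $\Omega^q$ if there are $\epsilon>0$ and $d>0$ such that for all $\omega\in\Omega^\theta(\sigma)$, all $\omega'\in\Omega^q$ at distance less than $\epsilon$ from $\Omega^\theta(\sigma)$ and all $a\in\operatorname{supp}\sigma$, $$\int\Big(\frac{q(y|a,\omega')}{q(y|a,\omega)}\Big)^{d}\,Q^*(dy|a)\le 1 .$$ **Corollary.** A model $\theta\in\Theta^q$ is $q$-constrained locally robust if it admits a uniformly strict Berk–Nash equilibrium $\sigma$ at which it is locally dominant with respect to $\Omega^q$. -/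

import Mathlib

open MeasureTheory

noncomputable section

namespace ModelSwitching

/-- The measure with density `f` with respect to `ν`. -/
def densityMeasure {X : Type*} [MeasurableSpace X] (ν : Measure X) (f : X → ℝ) : Measure X :=
  ν.withDensity (fun y => ENNReal.ofReal (f y))

/-- The objective environment: the outcome space is a Euclidean space or a compact subset of one;
`qStar a` is the density of the true outcome distribution under action `a` with respect to
the common reference measure `ν`; `u` is the flow payoff. -/
structure Environment (A : Type*) (n : ℕ) where
  Y : Set (EuclideanSpace ℝ (Fin n))
  Y_spec : Y = Set.univ ∨ IsCompact Y
  ν : Measure Y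
  qStar : A → Y → ℝ
  qStar_measurable : ∀ a, Measurable (qStar a)
  qStar_pos : ∀ a y, 0 < qStar a y
  qStar_mass : ∀ a, ∫⁻ y, ENNReal.ofReal (qStar a y) ∂ν = 1
  u : A → Y → ℝ
  u_integrable : ∀ a, Integrable (u a) (densityMeasure ν (qStar a))

variable {A : Type*} {n k : ℕ}

/-- The true outcome distribution `Q*(· | a)`. -/
def Environment.QStar (env : Environment A n) (a : A) : Measure env.Y :=
  densityMeasure env.ν (env.qStar a)

instance Environment.instIsProbabilityMeasureQStar (env : Environment A n) (a : A) :
    IsProbabilityMeasure (env.QStar a) := by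
  constructor
  simp only [Environment.QStar, densityMeasure, withDensity_apply _ MeasurableSet.univ,
    Measure.restrict_univ]
  exact env.qStar_mass a

/-- A subjective model: a nonempty finite parameter set in a Euclidean space, and for each action
and parameter a positive outcome density. The values of `q` outside `Ω` are irrelevant. -/
structure Model (env : Environment A n) (k : ℕ) where
  Ω : Finset (EuclideanSpace ℝ (Fin k))
  Ω_nonempty : Ω.Nonempty
  q : A → EuclideanSpace ℝ (Fin k) → env.Y → ℝ
  q_measurable : ∀ a, ∀ ω ∈ Ω, Measurable (q a ω)
  q_pos : ∀ a, ∀ ω ∈ Ω, ∀ y, 0 < q a ω y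
  q_mass : ∀ a, ∀ ω ∈ Ω, ∫⁻ y, ENNReal.ofReal (q a ω y) ∂env.ν = 1
  u_integrable : ∀ a, ∀ ω ∈ Ω, Integrable (env.u a) (densityMeasure env.ν (q a ω))
  log_ratio_bound : ∀ a, ∀ ω ∈ Ω, ∃ g : env.Y → ℝ, MemLp g 2 (env.QStar a) ∧
    ∀ᵐ y ∂(env.QStar a), |Real.log (env.qStar a y / q a ω y)| ≤ g y

namespace Model

variable {env : Environment A n}

/-- Beliefs over the parameters of a model (`Δ Ω^θ`). -/
abbrev Belief (θ : Model env k) : Type := stdSimplex ℝ θ.Ω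

/-- The belief gives positive weight to every parameter. -/
def FullSupport (θ : Model env k) (π : θ.Belief) : Prop := ∀ ω : θ.Ω, 0 < π.1 ω

theorem sum_belief_mul_q_pos (θ : Model env k) (a : A) (y : env.Y) (π : θ.Belief) :
    0 < ∑ ω : θ.Ω, π.1 ω * θ.q a ω y := by
  obtain ⟨ω, -, hω⟩ : ∃ ω ∈ (Finset.univ : Finset θ.Ω), 0 < π.1 ω := by
    apply Finset.exists_lt_of_sum_lt
    rw [Finset.sum_const_zero, π.2.2]
    exact one_pos
  exact Finset.sum_pos' (fun i _ => mul_nonneg (π.2.1 i) (θ.q_pos a i i.2 y).le)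
    ⟨ω, Finset.mem_univ _, mul_pos hω (θ.q_pos a ω ω.2 y)⟩

/-- The Bayesian operator `B^θ(a, y, π)`. -/
def bayes (θ : Model env k) (a : A) (y : env.Y) (π : θ.Belief) : θ.Belief :=
  ⟨fun ω => π.1 ω * θ.q a ω y / ∑ ω' : θ.Ω, π.1 ω' * θ.q a ω' y,
    fun ω => div_nonneg (mul_nonneg (π.2.1 ω) (θ.q_pos a ω ω.2 y).le)
      (θ.sum_belief_mul_q_pos a y π).le,
    by rw [← Finset.sum_div, div_self (θ.sum_belief_mul_q_pos a y π).ne']⟩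

/-- The objective of the dynamic programming problem at belief `π` and action `a`, with
continuation value function `U`. -/
def objective (θ : Model env k) (δ : ℝ) (U : θ.Belief → ℝ) (π : θ.Belief) (a : A) : ℝ :=
  ∑ ω : θ.Ω, π.1 ω * ∫ y, (env.u a y + δ * U (θ.bayes a y π)) * θ.q a ω y ∂env.ν

/-- `U` is the value function: the bounded measurable solution of the Bellman equation. -/
def IsValueFunction (θ : Model env k) (δ : ℝ) (U : θ.Belief → ℝ) : Prop :=
  Measurable U ∧ (∃ C : ℝ, ∀ π, |U π| ≤ C) ∧
    ∀ π, IsGreatest (Set.range (θ.objective δ U π)) (U π)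

/-- A (measurable) pure optimal policy of an agent with discount factor `δ` who holds model `θ`. -/
def IsOptimalPolicy (θ : Model env k) (δ : ℝ) (pol : θ.Belief → A) : Prop :=
  (∀ a, MeasurableSet (pol ⁻¹' {a})) ∧
    ∃ U, θ.IsValueFunction δ U ∧ ∀ π b, θ.objective δ U π b ≤ θ.objective δ U π (pol π)

/-- The set `A_m^θ(π)` of myopically optimal actions. -/
def myopicOptimal (θ : Model env k) (π : θ.Belief) : Set A :=
  {a | ∀ b, ∑ ω : θ.Ω, π.1 ω * ∫ y, env.u b y * θ.q b ω y ∂env.ν ≤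
    ∑ ω : θ.Ω, π.1 ω * ∫ y, env.u a y * θ.q a ω y ∂env.ν}

/-- The posterior after a history of action-outcome pairs, most recent first. -/
def posterior (θ : Model env k) (π₀ : θ.Belief) : List (A × env.Y) → θ.Belief
  | [] => π₀
  | p :: h => θ.bayes p.1 p.2 (θ.posterior π₀ h)

/-- The likelihood `l_t^θ` of a history under the prior `π₀`. -/
def likelihood (θ : Model env k) (π₀ : θ.Belief) (h : List (A × env.Y)) : ℝ :=
  ∑ ω : θ.Ω, π₀.1 ω * (h.map (fun p => θ.q p.1 ω p.2)).prod

/-- A belief as a probability measure on the ambient Euclidean space. -/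
def beliefMeasure (θ : Model env k) (π : θ.Belief) : Measure (EuclideanSpace ℝ (Fin k)) :=
  ∑ ω : θ.Ω, ENNReal.ofReal (π.1 ω) • Measure.dirac (ω : EuclideanSpace ℝ (Fin k))

end Model

/-- The two models entertained by a switcher. -/
inductive Slot
  | initial
  | competing

/-- The other slot. -/
def Slot.other : Slot → Slot
  | .initial => .competing
  | .competing => .initial

/-- A switcher: an initial and a competing model, each with a prior and a policy. -/
structure Switcher (env : Environment A n) (k : ℕ) where
  model : Slot → Model env k
  prior : (i : Slot) → (model i).Belief
  policy : (i : Slot) → (model i).Belief → A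

namespace Switcher

variable {env : Environment A n}

/-- The likelihood of a history under the model in slot `i`. -/
def lik (S : Switcher env k) (i : Slot) (h : List (A × env.Y)) : ℝ :=
  (S.model i).likelihood (S.prior i) h

/-- The model choice after a history, by the Bayes factor rule with threshold `α > 1`. The Bayes
factor of the model in use is `1 < α`, so the largest Bayes factor exceeds `α` exactly when that
of the other model does. -/
def choice (S : Switcher env k) (α : ℝ) : List (A × env.Y) → Slot
  | [] => .initial
  | p :: h =>
    let m := S.choice α h
    if α < S.lik m.other (p :: h) / S.lik m (p :: h) then m.other else m

/-- The action after a history: the policy of the adopted model at its current posterior. -/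
def action (S : Switcher env k) (α : ℝ) (h : List (A × env.Y)) : A :=
  S.policy (S.choice α h) ((S.model (S.choice α h)).posterior (S.prior (S.choice α h)) h)

/-- The history before period `t`, given potential outcomes `s (a, τ)` of every
action `a` in every period `τ`. -/
def history (S : Switcher env k) (α : ℝ) (s : A × ℕ → env.Y) : ℕ → List (A × env.Y)
  | 0 => []
  | t + 1 =>
    let h := S.history α s t
    (S.action α h, s (S.action α h, t)) :: h

/-- The law of the potential outcomes: independent draws from the true distributions. -/
def _root_.ModelSwitching.Environment.outcomeLaw (env : Environment A n) :
    Measure (A × ℕ → env.Y) :=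
  Measure.infinitePi (fun p : A × ℕ => env.QStar p.1)

/-- The model choice converges to the initial model with positive probability. -/
def InitialPersists (S : Switcher env k) (α : ℝ) : Prop :=
  0 < env.outcomeLaw {s | ∃ T, ∀ t ≥ T, S.choice α (S.history α s t) = Slot.initial}

end Switcher

/-- The switcher with initial model `θ` and competing model `θ'`. -/
def mkSwitcher {env : Environment A n} (θ θ' : Model env k) (π : θ.Belief) (π' : θ'.Belief)
    (pol : θ.Belief → A) (pol' : θ'.Belief → A) : Switcher env k where
  model := fun i => match i with
    | .initial => θ
    | .competing => θ'
  prior := fun i => match i with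
    | .initial => π
    | .competing => π'
  policy := fun i => match i with
    | .initial => pol
    | .competing => pol'

/-- `θ` persists against `θ'` at the given priors and policies. -/
def PersistsAgainst {env : Environment A n} (α : ℝ) (θ θ' : Model env k) (π : θ.Belief)
    (π' : θ'.Belief) (pol : θ.Belief → A) (pol' : θ'.Belief → A) : Prop :=
  (mkSwitcher θ θ' π π' pol pol').InitialPersists α

/-- A parametric family of action-dependent outcome densities on a parameter set `Ωq`, whose
outcome distributions depend continuously (in the topology of weak convergence) on the
parameter. -/
structure Family (env : Environment A n) (k : ℕ) where
  Ωq : Set (EuclideanSpace ℝ (Fin k))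
  q : A → EuclideanSpace ℝ (Fin k) → env.Y → ℝ
  q_measurable : ∀ a, ∀ ω ∈ Ωq, Measurable (q a ω)
  q_nonneg : ∀ a, ∀ ω ∈ Ωq, ∀ y, 0 ≤ q a ω y
  q_mass : ∀ a, ∀ ω ∈ Ωq, ∫⁻ y, ENNReal.ofReal (q a ω y) ∂env.ν = 1
  q_continuous : ∀ a, ∀ f : BoundedContinuousFunction env.Y ℝ,
    ContinuousOn (fun ω => ∫ y, f y * q a ω y ∂env.ν) Ωq

/-- The `q`-family of models. -/
def Family.models {env : Environment A n} (F : Family env k) : Set (Model env k) :=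
  {θ | (θ.Ω : Set (EuclideanSpace ℝ (Fin k))) ⊆ F.Ωq ∧ ∀ a, ∀ ω ∈ θ.Ω, θ.q a ω = F.q a ω}

namespace Model

variable {env : Environment A n}

/-- `θ` is `q`-constrained locally robust, for the discount factor `δ` and the switching
threshold `α`. -/
def IsConstrainedLocallyRobust (θ : Model env k) (δ α : ℝ) (F : Family env k) : Prop :=
  ∃ ε > 0, ∃ π : θ.Belief, θ.FullSupport π ∧ ∃ pol : θ.Belief → A, θ.IsOptimalPolicy δ pol ∧
    ∀ θ' ∈ F.models,
      Metric.hausdorffDist (θ.Ω : Set (EuclideanSpace ℝ (Fin k))) θ'.Ω ≤ ε →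
    ∀ π' : θ'.Belief, θ'.FullSupport π' →
      levyProkhorovDist (θ.beliefMeasure π) (θ'.beliefMeasure π') ≤ ε →
    ∀ pol' : θ'.Belief → A, θ'.IsOptimalPolicy δ pol' →
      PersistsAgainst α θ θ' π π' pol pol'

/-- Kullback-Leibler divergence of the true distribution from the one predicted by `ω`. -/
def KL (θ : Model env k) (a : A) (ω : θ.Ω) : ℝ :=
  ∫ y, env.qStar a y * Real.log (env.qStar a y / θ.q a ω y) ∂env.ν

variable [Fintype A]

/-- The set `Ω^θ(σ)` of KL minimizers at the strategy `σ`. -/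
def klMinimizers (θ : Model env k) (σ : stdSimplex ℝ A) : Set θ.Ω :=
  {ω | ∀ ω' : θ.Ω, ∑ a, σ.1 a * θ.KL a ω ≤ ∑ a, σ.1 a * θ.KL a ω'}

/-- The belief is supported on the KL minimizers at `σ` (`π ∈ Δ Ω^θ(σ)`). -/
def SupportedOnMinimizers (θ : Model env k) (σ : stdSimplex ℝ A) (π : θ.Belief) : Prop :=
  ∀ ω, π.1 ω ≠ 0 → ω ∈ θ.klMinimizers σ

/-- Berk-Nash equilibrium. -/
def IsBerkNash (θ : Model env k) (σ : stdSimplex ℝ A) : Prop :=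
  ∃ π, θ.SupportedOnMinimizers σ π ∧ Function.support σ.1 ⊆ θ.myopicOptimal π

/-- Uniformly strict Berk-Nash equilibrium: pure and uniformly quasi-strict. -/
def IsUniformlyStrictBerkNash (θ : Model env k) (σ : stdSimplex ℝ A) : Prop :=
  θ.IsBerkNash σ ∧ (∃ a, Function.support σ.1 = {a}) ∧
    ∀ π, θ.SupportedOnMinimizers σ π → Function.support σ.1 = θ.myopicOptimal π

/-- Local dominance of `θ` at `σ` with respect to `Ωq`. -/
def IsLocallyDominant (θ : Model env k) (σ : stdSimplex ℝ A) (F : Family env k) : Prop :=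
  ∃ ε > 0, ∃ d > (0 : ℝ), ∀ ω ∈ θ.klMinimizers σ,
    ∀ ω' ∈ F.Ωq ∩ Metric.thickening ε (Subtype.val '' θ.klMinimizers σ),
    ∀ a ∈ Function.support σ.1,
      ∫⁻ y, ENNReal.ofReal ((F.q a ω' y / F.q a ω y) ^ d) ∂(env.QStar a) ≤ 1

end Model

end ModelSwitching

end

/-! Let `a` be the equilibrium action, `M` the set of divergence minimizers at `a`, and `ω₀` a point
of `M`. The prior is concentrated near `ω₀`, and the policy plays `a` whenever the belief puts mass
at most `c` outside `M`. While the initial model is kept and `a` is played, the data are i.i.d. from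
the true law under `a`. It therefore suffices that, with positive probability along such data, the
competing likelihood never exceeds `α` times the initial one and the posterior mass outside `M`
never exceeds `c`. Both follow from a single inequality: a weighted mixture of the likelihoods of
the competing parameters and of the parameters outside `M` stays below the likelihood of `ω₀`
forever. The total weight is below one because `α > 1` and the prior is concentrated
(`persistsAgainst_of_dichotomy`).

That inequality has positive probability (`iidLaw_mixture_le_pos`) when every component either
coincides with `ω₀` or has strictly larger divergence. Likelihood ratios against `ω₀` need not be
supermartingales under the true law, so two laws are used. Under the law predicted by `ω₀`, Ville's
inequality keeps the mixture below up to a finite time `T`, and Hellinger affinity makes the ratios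
of the distinct components tiny at `T`. On a finite horizon this event also has positive true
probability. After `T`, the strong law under the true distribution bounds the further growth of
those ratios, independently of the past.

The dichotomy comes from closeness of the models. Near `M`, local dominance and the equality case of
`exp x ≥ 1 + x` give it (`ae_eq_or_integral_log_neg`); near the other parameters, lower
semicontinuity of the divergence does (`Family.exists_forall_lt_integral_log`). The policy exists
because on beliefs supported in `M` experimentation is worthless, so `a` is strictly optimal there
also dynamically, and compactness extends this to nearby beliefs (`objective_lt_of_mem_face`,
`exists_optimalPolicy_near_face`). -/

namespace ModelSwitching

open ProbabilityTheory Filter Topology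

/-! ### Likelihoods of i.i.d. data: Ville's inequality, Hellinger affinity, negative drift -/

section IidLikelihood

variable {Y : Type*} [MeasurableSpace Y]

/-- The law of an i.i.d. sequence of draws from `Q`. -/
noncomputable abbrev iidLaw (Q : Measure Y) : Measure (ℕ → Y) := Measure.infinitePi fun _ : ℕ => Q

/-- The likelihood of the first `t` observations under the density `f`. -/
def iidLik {X : Type*} (f : X → ℝ) (t : ℕ) (s : ℕ → X) : ℝ := ∏ j ∈ Finset.range t, f (s j)

/-- The information in the first `T` observations. -/
abbrev pastSigma (Y : Type*) [MeasurableSpace Y] (T : ℕ) : MeasurableSpace (ℕ → Y) :=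
  ⨆ i ∈ Set.Iio T, MeasurableSpace.comap (fun s : ℕ → Y => s i) inferInstance

/-- The information in the observations from period `T` on. -/
abbrev futureSigma (Y : Type*) [MeasurableSpace Y] (T : ℕ) : MeasurableSpace (ℕ → Y) :=
  ⨆ i ∈ Set.Ici T, MeasurableSpace.comap (fun s : ℕ → Y => s i) inferInstance

theorem pastSigma_le (T : ℕ) : pastSigma Y T ≤ (inferInstance : MeasurableSpace (ℕ → Y)) :=
  iSup₂_le fun i _ => (measurable_pi_apply i).comap_le

theorem futureSigma_le (T : ℕ) : futureSigma Y T ≤ (inferInstance : MeasurableSpace (ℕ → Y)) :=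
  iSup₂_le fun i _ => (measurable_pi_apply i).comap_le

theorem measurable_eval_past {i T : ℕ} (h : i < T) :
    Measurable[pastSigma Y T] (fun s : ℕ → Y => s i) :=
  Measurable.mono (comap_measurable _)
    (le_iSup₂_of_le (f := fun i (_ : i ∈ Set.Iio T) =>
      MeasurableSpace.comap (fun s : ℕ → Y => s i) inferInstance) i h le_rfl) le_rfl

theorem measurable_eval_future {i T : ℕ} (h : T ≤ i) :
    Measurable[futureSigma Y T] (fun s : ℕ → Y => s i) :=
  Measurable.mono (comap_measurable _)
    (le_iSup₂_of_le (f := fun i (_ : i ∈ Set.Ici T) =>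
      MeasurableSpace.comap (fun s : ℕ → Y => s i) inferInstance) i h le_rfl) le_rfl

theorem measurable_shift_future (T : ℕ) :
    Measurable[futureSigma Y T] (fun (s : ℕ → Y) (j : ℕ) => s (T + j)) :=
  @measurable_pi_lambda _ _ _ (futureSigma Y T) _ _
    fun j => measurable_eval_future (Nat.le_add_right T j)

theorem measurable_iidLik_past {f : Y → ℝ} (hf : Measurable f) {t T : ℕ} (h : t ≤ T) :
    Measurable[pastSigma Y T] (iidLik f t) := by
  unfold iidLik
  refine @Finset.measurable_fun_prod _ _ _ _ _ _ (pastSigma Y T) _ _ fun j hj => ?_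
  exact hf.comp (measurable_eval_past ((Finset.mem_range.1 hj).trans_le h))

theorem measurable_iidLik {f : Y → ℝ} (hf : Measurable f) (t : ℕ) : Measurable (iidLik f t) :=
  (measurable_iidLik_past hf le_rfl).mono (pastSigma_le t) le_rfl

theorem iidLik_pos {X : Type*} {f : X → ℝ} (hf : ∀ x, 0 < f x) (t : ℕ) (s : ℕ → X) : 0 < iidLik f t s :=
  Finset.prod_pos fun _ _ => hf _

theorem iidLik_succ {X : Type*} (f : X → ℝ) (t : ℕ) (s : ℕ → X) :
    iidLik f (t + 1) s = iidLik f t s * f (s t) :=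
  Finset.prod_range_succ _ _

theorem iidLik_add {X : Type*} (f : X → ℝ) (T t : ℕ) (s : ℕ → X) :
    iidLik f (T + t) s = iidLik f T s * iidLik f t (fun j => s (T + j)) :=
  Finset.prod_range_add _ _ _

/-- Distinct densities have Hellinger affinity less than one. -/
theorem lintegral_sqrt_mul_lt_one {Q : Measure Y} {f g : Y → ℝ} (hf : Measurable f) (hg : Measurable g)
    (hf0 : ∀ y, 0 < f y) (hg0 : ∀ y, 0 < g y) (hf1 : ∫⁻ y, ENNReal.ofReal (f y) ∂Q = 1)
    (hg1 : ∫⁻ y, ENNReal.ofReal (g y) ∂Q = 1) (hne : ¬ f =ᵐ[Q] g) :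
    ∫⁻ y, ENNReal.ofReal √(f y * g y) ∂Q < 1 := by
  have amgm : ∀ y, √(f y * g y) ≤ (f y + g y) / 2 := fun y => by
    rw [Real.sqrt_le_left (by have := hf0 y; have := hg0 y; positivity)]
    nlinarith [sq_nonneg (f y - g y)]
  have one : ∫⁻ y, ENNReal.ofReal ((f y + g y) / 2) ∂Q = 1 := by
    have : ∀ y, ENNReal.ofReal ((f y + g y) / 2) =
        (ENNReal.ofReal (f y) + ENNReal.ofReal (g y)) * 2⁻¹ := fun y => by
      rw [ENNReal.ofReal_div_of_pos two_pos, ENNReal.ofReal_add (hf0 y).le (hg0 y).le,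
        ENNReal.ofReal_ofNat, div_eq_mul_inv]
    simp_rw [this]
    rw [lintegral_mul_const _ (hf.ennreal_ofReal.fun_add hg.ennreal_ofReal),
      lintegral_add_left hf.ennreal_ofReal, hf1, hg1, one_add_one_eq_two]
    exact ENNReal.mul_inv_cancel two_ne_zero ENNReal.ofNat_ne_top
  rw [← one]
  refine lintegral_strict_mono_of_ae_le_of_frequently_ae_lt
    ((hf.add hg).div_const 2).ennreal_ofReal.aemeasurable ?_
    (ae_of_all _ fun y => ENNReal.ofReal_le_ofReal (amgm y)) ?_
  · refine ne_top_of_le_ne_top ENNReal.one_ne_top (one ▸ lintegral_mono fun y => ?_)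
    exact ENNReal.ofReal_le_ofReal (amgm y)
  -- Equality in the AM-GM bound forces `f y = g y`, so the bound is strict on the non-null set
  -- where the densities differ.
  · refine Frequently.mono (Filter.not_eventually.1 hne) fun y hy heq => hy ?_
    have h1 : √(f y * g y) = (f y + g y) / 2 :=
      (ENNReal.ofReal_eq_ofReal_iff (Real.sqrt_nonneg _)
        (by have := hf0 y; have := hg0 y; positivity)).1 heq
    have h2 := Real.sq_sqrt (mul_pos (hf0 y) (hg0 y)).le
    rw [h1] at h2
    have : (f y - g y) ^ 2 = 0 := by linarith
    exact sub_eq_zero.1 (pow_eq_zero_iff two_ne_zero |>.1 this)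

variable {Q : Measure Y} [IsProbabilityMeasure Q]

theorem iIndepFun_eval_iidLaw : iIndepFun (fun (i : ℕ) (s : ℕ → Y) => s i) (iidLaw Q) :=
  iIndepFun_infinitePi (X := fun _ y => y) fun _ => measurable_id

/-- Used both to integrate out one observation at a time and to join an event about the first `T`
observations to an event about all later ones. -/
theorem indep_past_future (T : ℕ) : Indep (pastSigma Y T) (futureSigma Y T) (iidLaw Q) := by
  refine indep_iSup_of_disjoint (fun i => (measurable_pi_apply i).comap_le)
    (iIndepFun_eval_iidLaw (Q := Q)) ?_
  exact Set.disjoint_left.2 fun i h1 h2 => absurd (Set.mem_Iio.1 h1) (not_lt.2 h2)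

theorem lintegral_eval_iidLaw {g : Y → ENNReal} (hg : Measurable g) (i : ℕ) :
    ∫⁻ s, g (s i) ∂(iidLaw Q) = ∫⁻ y, g y ∂Q :=
  (measurePreserving_eval_infinitePi (fun _ : ℕ => Q) i).lintegral_comp hg

theorem map_shift_iidLaw (T : ℕ) :
    (iidLaw Q).map (fun s j => s (T + j)) = iidLaw Q :=
  Measure.map_infinitePi_infinitePi_of_inj (P := fun _ : ℕ => Q) (add_right_injective T)

/-- Integrating out the last observation. -/
theorem lintegral_past_mul_iidLik_succ {f : Y → ℝ} (hf : Measurable f) (hf0 : ∀ y, 0 < f y)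
    (T : ℕ) {G : (ℕ → Y) → ENNReal} (hG : Measurable[pastSigma Y T] G) :
    ∫⁻ s, G s * ENNReal.ofReal (iidLik f (T + 1) s) ∂(iidLaw Q) =
      (∫⁻ s, G s * ENNReal.ofReal (iidLik f T s) ∂(iidLaw Q)) *
        ∫⁻ y, ENNReal.ofReal (f y) ∂Q := by
  rw [← lintegral_eval_iidLaw (Q := Q) hf.ennreal_ofReal T]
  rw [← lintegral_mul_eq_lintegral_mul_lintegral_of_independent_measurableSpace
    (pastSigma_le T) (futureSigma_le T) (indep_past_future T)
    (f := fun s => G s * ENNReal.ofReal (iidLik f T s))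
    (g := fun s => ENNReal.ofReal (f (s T)))]
  · refine lintegral_congr fun s => ?_
    rw [iidLik_succ, ENNReal.ofReal_mul (iidLik_pos hf0 T s).le, mul_assoc]
  · exact hG.mul (measurable_iidLik_past hf le_rfl).ennreal_ofReal
  · exact hf.ennreal_ofReal.comp (measurable_eval_future le_rfl)

theorem lintegral_iidLik {f : Y → ℝ} (hf : Measurable f) (hf0 : ∀ y, 0 < f y) (T : ℕ) :
    ∫⁻ s, ENNReal.ofReal (iidLik f T s) ∂(iidLaw Q) = (∫⁻ y, ENNReal.ofReal (f y) ∂Q) ^ T := by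
  induction T with
  | zero => simp [iidLik]
  | succ T ih =>
    have := lintegral_past_mul_iidLik_succ (Q := Q) hf hf0 T (G := fun _ => 1)
      (@measurable_const _ _ _ (pastSigma Y T) _)
    simp only [one_mul] at this
    rw [this, ih, pow_succ]

variable {ι : Type*} [Fintype ι]

/-- The event that by period `T` the mixture with weights `u` of the likelihoods under the
densities `r i` has overtaken the likelihood under `r₀`. -/
def overtaken {X : Type*} (r₀ : X → ℝ) (r : ι → X → ℝ) (u : ι → ℝ) (T : ℕ) : Set (ℕ → X) :=
  {s | ∃ t ≤ T, iidLik r₀ t s < ∑ i, u i * iidLik (r i) t s}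

theorem measurableSet_overtaken {r₀ : Y → ℝ} {r : ι → Y → ℝ} (u : ι → ℝ) (h₀ : Measurable r₀)
    (h : ∀ i, Measurable (r i)) (T : ℕ) :
    MeasurableSet[pastSigma Y T] (overtaken r₀ r u T) := by
  have : overtaken r₀ r u T =
      ⋃ t ∈ Set.Iic T, {s | iidLik r₀ t s < ∑ i, u i * iidLik (r i) t s} := by
    ext s; simp [overtaken]
  rw [this]
  refine @MeasurableSet.biUnion _ _ (pastSigma Y T) _ _ (Set.to_countable _) fun t ht => ?_
  exact measurableSet_lt (measurable_iidLik_past h₀ ht)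
    (Finset.measurable_fun_sum _ fun i _ => (measurable_iidLik_past (h i) ht).const_mul _)

theorem overtaken_mono {X : Type*} (r₀ : X → ℝ) (r : ι → X → ℝ) (u : ι → ℝ) {S T : ℕ} (h : S ≤ T) :
    overtaken r₀ r u S ⊆ overtaken r₀ r u T :=
  fun _ ⟨t, ht, hs⟩ => ⟨t, ht.trans h, hs⟩

/-- The martingale property of the likelihood: an event decided by time `T` has the same probability
under the law with density `f` whether that law is written at horizon `T` or `T + 1`. -/
theorem setLIntegral_past_iidLik_succ {f : Y → ℝ} (hf : Measurable f) (hf0 : ∀ y, 0 < f y)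
    (hf1 : ∫⁻ y, ENNReal.ofReal (f y) ∂Q = 1) (T : ℕ) {B : Set (ℕ → Y)}
    (hB : MeasurableSet[pastSigma Y T] B) :
    ∫⁻ s in B, ENNReal.ofReal (iidLik f (T + 1) s) ∂(iidLaw Q) =
      ∫⁻ s in B, ENNReal.ofReal (iidLik f T s) ∂(iidLaw Q) := by
  have key := lintegral_past_mul_iidLik_succ (Q := Q) hf hf0 T (G := B.indicator fun _ => 1)
    (measurable_const.indicator hB)
  rw [hf1, mul_one] at key
  have hB' := pastSigma_le T _ hB
  rw [← lintegral_indicator hB', ← lintegral_indicator hB']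
  convert key using 3 with s s <;> by_cases hs : s ∈ B <;> simp [hs]

/-- Ville's maximal inequality, for the mixture likelihood ratio and the law with density `r₀`. -/
theorem setLIntegral_overtaken_le {r₀ : Y → ℝ} {r : ι → Y → ℝ} {u : ι → ℝ}
    (hu : ∀ i, 0 ≤ u i)
    (h₀ : Measurable r₀) (h : ∀ i, Measurable (r i))
    (h₀0 : ∀ y, 0 < r₀ y) (h0 : ∀ i y, 0 < r i y)
    (h₀1 : ∫⁻ y, ENNReal.ofReal (r₀ y) ∂Q = 1) (h1 : ∀ i, ∫⁻ y, ENNReal.ofReal (r i y) ∂Q = 1)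
    (T : ℕ) :
    ∫⁻ s in overtaken r₀ r u T, ENNReal.ofReal (iidLik r₀ T s) ∂(iidLaw Q) ≤
      ∑ i, ENNReal.ofReal (u i) *
        ∫⁻ s in overtaken r₀ r u T, ENNReal.ofReal (iidLik (r i) T s) ∂(iidLaw Q) := by
  have pointwise : ∀ t (B : Set (ℕ → Y)), MeasurableSet B →
      (∀ s ∈ B, iidLik r₀ t s < ∑ i, u i * iidLik (r i) t s) →
      ∫⁻ s in B, ENNReal.ofReal (iidLik r₀ t s) ∂(iidLaw Q) ≤
        ∑ i, ENNReal.ofReal (u i) *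
          ∫⁻ s in B, ENNReal.ofReal (iidLik (r i) t s) ∂(iidLaw Q) := by
    intro t B hB hlt
    have e : ∀ i, ENNReal.ofReal (u i) *
          ∫⁻ s in B, ENNReal.ofReal (iidLik (r i) t s) ∂(iidLaw Q) =
        ∫⁻ s in B, ENNReal.ofReal (u i) * ENNReal.ofReal (iidLik (r i) t s) ∂(iidLaw Q) :=
      fun i => (lintegral_const_mul _ (measurable_iidLik (h i) t).ennreal_ofReal).symm
    simp_rw [e]
    rw [← lintegral_finsetSum _ fun i _ =>
      (measurable_iidLik (h i) t).ennreal_ofReal.const_mul _]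
    refine setLIntegral_mono' hB fun s hs => ?_
    refine (ENNReal.ofReal_le_ofReal (hlt s hs).le).trans ?_
    rw [ENNReal.ofReal_sum_of_nonneg fun i _ => mul_nonneg (hu i) (iidLik_pos (h0 i) t s).le]
    exact Finset.sum_le_sum fun i _ => (ENNReal.ofReal_mul (hu i)).le
  induction T with
  | zero =>
    refine pointwise 0 _ (pastSigma_le 0 _ (measurableSet_overtaken u h₀ h 0)) ?_
    rintro s ⟨t, ht, hs⟩
    obtain rfl := Nat.le_zero.1 ht
    exact hs
  | succ T ih =>
    have mT := measurableSet_overtaken u h₀ h T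
    have mT' := pastSigma_le T _ mT
    have mS' := pastSigma_le (T + 1) _ (measurableSet_overtaken u h₀ h (T + 1))
    have hsub := overtaken_mono r₀ r u (Nat.le_succ T)
    -- Decomposition by first crossing time. Paths that crossed by `T` are handled by the martingale
    -- property; the others cross exactly at `T + 1`, where the pointwise comparison applies.
    have split : ∀ f : (ℕ → Y) → ENNReal,
        ∫⁻ s in overtaken r₀ r u (T + 1), f s ∂(iidLaw Q) =
          ∫⁻ s in overtaken r₀ r u T, f s ∂(iidLaw Q) +
          ∫⁻ s in overtaken r₀ r u (T + 1) \ overtaken r₀ r u T, f s ∂(iidLaw Q) := by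
      intro f
      rw [← lintegral_inter_add_sdiff f (overtaken r₀ r u (T + 1)) mT',
        Set.inter_eq_right.2 hsub]
    simp_rw [split, mul_add, Finset.sum_add_distrib]
    refine add_le_add ?_ (pointwise _ _ (mS'.diff mT') ?_)
    · rw [setLIntegral_past_iidLik_succ h₀ h₀0 h₀1 T mT]
      simp_rw [setLIntegral_past_iidLik_succ (h _) (h0 _) (h1 _) T mT]
      exact ih
    · rintro s ⟨⟨t, ht, hs⟩, hns⟩
      rcases Nat.le_succ_iff.1 ht with ht | rfl
      · exact absurd ⟨t, ht, hs⟩ hns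
      · exact hs

/-- Each component has total mass one, so the bound on the crossing probability is uniform in the
horizon. -/
theorem setLIntegral_overtaken_le_sum {r₀ : Y → ℝ} {r : ι → Y → ℝ} {u : ι → ℝ}
    (hu : ∀ i, 0 ≤ u i)
    (h₀ : Measurable r₀) (h : ∀ i, Measurable (r i))
    (h₀0 : ∀ y, 0 < r₀ y) (h0 : ∀ i y, 0 < r i y)
    (h₀1 : ∫⁻ y, ENNReal.ofReal (r₀ y) ∂Q = 1) (h1 : ∀ i, ∫⁻ y, ENNReal.ofReal (r i y) ∂Q = 1)
    (T : ℕ) :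
    ∫⁻ s in overtaken r₀ r u T, ENNReal.ofReal (iidLik r₀ T s) ∂(iidLaw Q) ≤
      ENNReal.ofReal (∑ i, u i) := by
  refine (setLIntegral_overtaken_le hu h₀ h h₀0 h0 h₀1 h1 T).trans ?_
  rw [ENNReal.ofReal_sum_of_nonneg fun i _ => hu i]
  refine Finset.sum_le_sum fun i _ => ?_
  calc _ ≤ ENNReal.ofReal (u i) * ∫⁻ s, ENNReal.ofReal (iidLik (r i) T s) ∂(iidLaw Q) := by
        gcongr; exact Measure.restrict_le_self
    _ = _ := by rw [lintegral_iidLik (h i) (h0 i), h1 i, one_pow, mul_one]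

/-- Under the law with density `f`, the likelihood ratio of a different density vanishes. -/
theorem tendsto_setLIntegral_iidLik_ratio {f g : Y → ℝ} (hf : Measurable f) (hg : Measurable g)
    (hf0 : ∀ y, 0 < f y) (hg0 : ∀ y, 0 < g y) (hf1 : ∫⁻ y, ENNReal.ofReal (f y) ∂Q = 1)
    (hg1 : ∫⁻ y, ENNReal.ofReal (g y) ∂Q = 1) (hne : ¬ f =ᵐ[Q] g) {κ : ℝ} (hκ : 0 < κ) :
    Tendsto (fun T => ∫⁻ s in {s | κ * iidLik f T s < iidLik g T s},
      ENNReal.ofReal (iidLik f T s) ∂(iidLaw Q)) atTop (𝓝 0) := by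
  have hlt := lintegral_sqrt_mul_lt_one hf hg hf0 hg0 hf1 hg1 hne
  have hm : Measurable fun y => √(f y * g y) := (hf.mul hg).sqrt
  -- A Chernoff bound with exponent one half: on the event, the likelihood of `f` is at most
  -- `(√κ)⁻¹` times the geometric mean of the two likelihoods, whose integral is the `T`-th power of
  -- the affinity.
  have bound : ∀ T, ∫⁻ s in {s | κ * iidLik f T s < iidLik g T s},
      ENNReal.ofReal (iidLik f T s) ∂(iidLaw Q) ≤
        ENNReal.ofReal (√κ)⁻¹ * (∫⁻ y, ENNReal.ofReal √(f y * g y) ∂Q) ^ T := by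
    intro T
    rw [← lintegral_iidLik hm (fun y => Real.sqrt_pos.2 (mul_pos (hf0 y) (hg0 y))),
      ← lintegral_const_mul _ (measurable_iidLik hm T).ennreal_ofReal]
    refine (setLIntegral_mono' (measurableSet_lt ((measurable_iidLik hf T).const_mul κ)
      (measurable_iidLik hg T)) fun s hs => ?_).trans
      (lintegral_mono' Measure.restrict_le_self le_rfl)
    rw [← ENNReal.ofReal_mul (by positivity)]
    refine ENNReal.ofReal_le_ofReal ?_
    have e : iidLik (fun y => √(f y * g y)) T s = √(iidLik f T s * iidLik g T s) := by
      have hp : ∀ t, √(iidLik f t s * iidLik g t s) = iidLik (fun y => √(f y * g y)) t s := by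
        intro t
        induction t with
        | zero => simp [iidLik]
        | succ t ih =>
          rw [iidLik_succ, iidLik_succ, iidLik_succ, ← ih, ← Real.sqrt_mul
            (mul_pos (iidLik_pos hf0 t s) (iidLik_pos hg0 t s)).le]
          congr 1; ring
      exact (hp T).symm
    have hF := iidLik_pos hf0 T s
    rw [e, ← div_eq_inv_mul, le_div_iff₀ (Real.sqrt_pos.2 hκ)]
    have h3 : √(κ * iidLik f T s * iidLik f T s) = √κ * iidLik f T s := by
      rw [mul_assoc, Real.sqrt_mul hκ.le, Real.sqrt_mul_self hF.le]
    rw [mul_comm, ← h3]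
    refine Real.sqrt_le_sqrt ?_
    rw [mul_comm]
    exact mul_le_mul_of_nonneg_left (le_of_lt hs) hF.le
  refine tendsto_of_tendsto_of_tendsto_of_le_of_le tendsto_const_nhds ?_
    (fun _ => zero_le) bound
  have := ENNReal.Tendsto.const_mul (ENNReal.tendsto_pow_atTop_nhds_zero_of_lt_one hlt)
    (a := ENNReal.ofReal (√κ)⁻¹) (Or.inr ENNReal.ofReal_ne_top)
  rwa [mul_zero] at this

/-- A likelihood ratio with negative drift is almost surely bounded. -/
theorem ae_exists_iidLik_le {f g : Y → ℝ} (hf0 : ∀ y, 0 < f y) (hg0 : ∀ y, 0 < g y)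
    (hf : Measurable f) (hg : Measurable g)
    (hint : Integrable (fun y => Real.log (g y / f y)) Q)
    (hneg : ∫ y, Real.log (g y / f y) ∂Q < 0) :
    ∀ᵐ s ∂(iidLaw Q), ∃ K : ℕ, ∀ t, iidLik g t s ≤ K * iidLik f t s := by
  set ℓ : Y → ℝ := fun y => Real.log (g y / f y) with hℓ
  have hm : Measurable ℓ := Real.measurable_log.comp (hg.div hf)
  have hmp : ∀ i : ℕ, MeasurePreserving (fun s : ℕ → Y => s i) (iidLaw Q) Q := fun i =>
    measurePreserving_eval_infinitePi (fun _ : ℕ => Q) i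
  have slln := strong_law_ae_real (μ := iidLaw Q) (fun i s => ℓ (s i))
    ((hmp 0).integrable_comp_of_integrable hint)
    (fun i j hij => ((iIndepFun_eval_iidLaw (Q := Q)).indepFun hij).comp hm hm)
    (fun i => by
      have h : IdentDistrib (fun s : ℕ → Y => s i) (fun s => s 0) (iidLaw Q) (iidLaw Q) :=
        ⟨(measurable_pi_apply i).aemeasurable, (measurable_pi_apply 0).aemeasurable, by
          rw [(hmp i).map_eq, (hmp 0).map_eq]⟩
      exact h.comp hm)
  have mean : ∫ s, ℓ (s 0) ∂(iidLaw Q) = ∫ y, ℓ y ∂Q := by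
    have := integral_map (μ := iidLaw Q) (φ := fun s : ℕ → Y => s 0)
      (measurable_pi_apply 0).aemeasurable (f := ℓ) hm.aestronglyMeasurable
    rw [(hmp 0).map_eq] at this
    exact this.symm
  filter_upwards [slln] with s hs
  rw [mean] at hs
  have hlog : ∀ t, iidLik g t s = Real.exp (∑ i ∈ Finset.range t, ℓ (s i)) * iidLik f t s := by
    intro t
    rw [Real.exp_sum, iidLik, iidLik, ← Finset.prod_mul_distrib]
    refine Finset.prod_congr rfl fun i _ => ?_
    rw [Real.exp_log (div_pos (hg0 _) (hf0 _)), div_mul_cancel₀ _ (hf0 _).ne']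
  have hev : ∀ᶠ t : ℕ in atTop, ∑ i ∈ Finset.range t, ℓ (s i) ≤ 0 := by
    filter_upwards [hs.eventually (gt_mem_nhds hneg), eventually_gt_atTop 0] with t ht h0
    have : (0 : ℝ) < t := Nat.cast_pos.2 h0
    exact ((div_neg_iff.1 ht).resolve_left fun h => absurd h.2 (not_lt.2 this.le)).1.le
  obtain ⟨T, hT⟩ := eventually_atTop.1 hev
  -- The sum dominates each ratio before `T`; the `1` dominates those after it, where the log ratio
  -- is nonpositive.
  obtain ⟨K, hK⟩ := exists_nat_ge
    (1 + ∑ t ∈ Finset.range T, Real.exp (∑ i ∈ Finset.range t, ℓ (s i)))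
  refine ⟨K, fun t => ?_⟩
  rw [hlog]
  refine mul_le_mul_of_nonneg_right (le_trans ?_ hK) (iidLik_pos hf0 t s).le
  have hsum : 0 ≤ ∑ t ∈ Finset.range T, Real.exp (∑ i ∈ Finset.range t, ℓ (s i)) :=
    Finset.sum_nonneg fun _ _ => (Real.exp_pos _).le
  rcases lt_or_ge t T with h | h
  · have := Finset.single_le_sum (f := fun t => Real.exp (∑ i ∈ Finset.range t, ℓ (s i)))
      (fun _ _ => (Real.exp_pos _).le) (Finset.mem_range.2 h)
    linarith
  · have := Real.exp_le_one_iff.2 (hT t h)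
    linarith

end IidLikelihood

/-! ### A mixture of likelihoods that stays below a reference likelihood forever -/

section IidLikelihood

variable {Y : Type*} [MeasurableSpace Y] {Q : Measure Y} [IsProbabilityMeasure Q]
  {ι : Type*} [Fintype ι]

/-- Some finite bound on all the likelihood ratios with negative drift holds with positive
probability. -/
theorem exists_bound_iidLik_pos {r₀ : Y → ℝ} {r : ι → Y → ℝ} (N : ι → Prop)
    (h₀ : Measurable r₀) (h : ∀ i, Measurable (r i))
    (h₀0 : ∀ y, 0 < r₀ y) (h0 : ∀ i y, 0 < r i y)
    (hN : ∀ i, N i → Integrable (fun y => Real.log (r i y / r₀ y)) Q ∧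
      ∫ y, Real.log (r i y / r₀ y) ∂Q < 0) :
    ∃ K : ℕ, 0 < iidLaw Q {s | ∀ i, N i → ∀ t, iidLik (r i) t s ≤ K * iidLik r₀ t s} := by
  have hae : ∀ᵐ s ∂(iidLaw Q), ∀ i, N i → ∃ K : ℕ, ∀ t, iidLik (r i) t s ≤ K * iidLik r₀ t s := by
    refine ae_all_iff.2 fun i => ?_
    by_cases hi : N i
    · filter_upwards [ae_exists_iidLik_le h₀0 (h0 i) h₀ (h i) (hN i hi).1 (hN i hi).2] with s hs _
      exact hs
    · exact ae_of_all _ fun _ hi' => absurd hi' hi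
  have hU : iidLaw Q (⋃ K : ℕ,
      {s | ∀ i, N i → ∀ t, iidLik (r i) t s ≤ K * iidLik r₀ t s}) = 1 := by
    rw [← measure_univ (μ := iidLaw Q)]
    refine measure_congr (eventuallyEq_univ.2 ?_)
    filter_upwards [hae] with s hs
    have hs' : ∀ i, ∃ K : ℕ, N i → ∀ t, iidLik (r i) t s ≤ K * iidLik r₀ t s := fun i => by
      by_cases hi : N i
      · obtain ⟨K, hK⟩ := hs i hi
        exact ⟨K, fun _ => hK⟩
      · exact ⟨0, fun hi' => absurd hi' hi⟩
    choose K hK using hs'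
    refine Set.mem_iUnion.2 ⟨∑ i, K i, fun i hi t => (hK i hi t).trans ?_⟩
    refine mul_le_mul_of_nonneg_right ?_ (iidLik_pos h₀0 t s).le
    exact_mod_cast Finset.single_le_sum (f := K) (fun _ _ => Nat.zero_le _) (Finset.mem_univ i)
  exact exists_measure_pos_of_not_measure_iUnion_null (by rw [hU]; exact one_ne_zero)

theorem setLIntegral_biUnion_finset_le {X κ : Type*} [MeasurableSpace X] {μ : Measure X}
    (s : Finset κ) (t : κ → Set X) (f : X → ENNReal) :
    ∫⁻ x in ⋃ i ∈ s, t i, f x ∂μ ≤ ∑ i ∈ s, ∫⁻ x in t i, f x ∂μ := by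
  classical
  induction s using Finset.induction_on with
  | empty => simp
  | insert i s hi ih =>
    rw [Finset.sum_insert hi, Finset.set_biUnion_insert]
    exact (lintegral_union_le _ _ _).trans (add_le_add le_rfl ih)

/-- With positive probability the mixture has not overtaken `r₀` by some period, and the likelihood
ratios of the distinct densities are small then. -/
theorem exists_good_past_pos {r₀ : Y → ℝ} {r : ι → Y → ℝ} {u : ι → ℝ}
    (hu : ∀ i, 0 ≤ u i) (hu1 : ∑ i, u i < 1)
    (h₀ : Measurable r₀) (h : ∀ i, Measurable (r i))
    (h₀0 : ∀ y, 0 < r₀ y) (h0 : ∀ i y, 0 < r i y)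
    (h₀1 : ∫⁻ y, ENNReal.ofReal (r₀ y) ∂Q = 1) (h1 : ∀ i, ∫⁻ y, ENNReal.ofReal (r i y) ∂Q = 1)
    {κ : ℝ} (hκ : 0 < κ) :
    ∃ T, ∃ B : Set (ℕ → Y), MeasurableSet[pastSigma Y T] B ∧ 0 < iidLaw Q B ∧
      ∀ s ∈ B, (∀ t ≤ T, ∑ i, u i * iidLik (r i) t s ≤ iidLik r₀ t s) ∧
        ∀ i, ¬ r₀ =ᵐ[Q] r i → iidLik (r i) T s ≤ κ * iidLik r₀ T s := by
  classical
  set N : Finset ι := Finset.univ.filter fun i => ¬ r₀ =ᵐ[Q] r i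
  set D : ℕ → ι → Set (ℕ → Y) := fun T i => {s | κ * iidLik r₀ T s < iidLik (r i) T s}
  -- The bad event is a crossing by `T` or a distinct ratio above `κ` at `T`. Under the law with
  -- density `r₀` the first has probability at most the total weight and the second vanishes, so the
  -- sum drops below one.
  have hlim : Tendsto (fun T => ENNReal.ofReal (∑ i, u i) +
      ∑ i ∈ N, ∫⁻ s in D T i, ENNReal.ofReal (iidLik r₀ T s) ∂(iidLaw Q)) atTop
      (𝓝 (ENNReal.ofReal (∑ i, u i) + ∑ i ∈ N, 0)) := by
    refine tendsto_const_nhds.add (tendsto_finsetSum _ fun i hi => ?_)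
    exact tendsto_setLIntegral_iidLik_ratio h₀ (h i) h₀0 (h0 i) h₀1 (h1 i)
      (Finset.mem_filter.1 hi).2 hκ
  rw [Finset.sum_const_zero, add_zero] at hlim
  have hlt : ENNReal.ofReal (∑ i, u i) < 1 := by
    rw [← ENNReal.ofReal_one]
    exact (ENNReal.ofReal_lt_ofReal_iff one_pos).2 hu1
  obtain ⟨T, hT⟩ := (hlim.eventually (gt_mem_nhds hlt)).exists
  set bad : Set (ℕ → Y) := overtaken r₀ r u T ∪ ⋃ i ∈ N, D T i with hbad
  have mbad : MeasurableSet[pastSigma Y T] bad := by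
    refine (measurableSet_overtaken u h₀ h T).union ?_
    refine Finset.measurableSet_biUnion _ fun i _ => ?_
    exact measurableSet_lt ((measurable_iidLik_past h₀ le_rfl).const_mul κ)
      (measurable_iidLik_past (h i) le_rfl)
  refine ⟨T, badᶜ, mbad.compl, ?_, ?_⟩
  -- Return to `Q`: on the first `T` observations the law with density `r₀` is absolutely
  -- continuous, so a `Q`-null good event would leave the bad event with full mass one.
  · rw [pos_iff_ne_zero]
    intro hzero
    have htot := lintegral_iidLik (Q := Q) h₀ h₀0 T
    rw [h₀1, one_pow, ← lintegral_add_compl _ (pastSigma_le T _ mbad),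
      setLIntegral_measure_zero _ _ hzero, add_zero] at htot
    refine absurd htot (ne_of_lt (lt_of_le_of_lt ?_ hT))
    refine (lintegral_union_le _ _ _).trans (add_le_add ?_ ?_)
    · exact setLIntegral_overtaken_le_sum hu h₀ h h₀0 h0 h₀1 h1 T
    · exact setLIntegral_biUnion_finset_le _ _ _
  · intro s hs
    rw [hbad, Set.compl_union] at hs
    refine ⟨fun t ht => not_lt.1 fun hlt => hs.1 ⟨t, ht, hlt⟩, fun i hi => not_lt.1 fun hlt => ?_⟩
    exact hs.2 (Set.mem_biUnion (Finset.mem_coe.2 (Finset.mem_filter.2 ⟨Finset.mem_univ i, hi⟩)) hlt)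

/-- A mixture of likelihoods of total weight less than one stays below the likelihood under `r₀`
forever with positive probability, when each density in the mixture either agrees with `r₀`
or fits the data strictly worse. -/
theorem iidLaw_mixture_le_pos {r₀ : Y → ℝ} {r : ι → Y → ℝ} {u : ι → ℝ}
    (hu : ∀ i, 0 ≤ u i) (hu1 : ∑ i, u i < 1)
    (h₀ : Measurable r₀) (h : ∀ i, Measurable (r i))
    (h₀0 : ∀ y, 0 < r₀ y) (h0 : ∀ i y, 0 < r i y)
    (h₀1 : ∫⁻ y, ENNReal.ofReal (r₀ y) ∂Q = 1) (h1 : ∀ i, ∫⁻ y, ENNReal.ofReal (r i y) ∂Q = 1)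
    (hdich : ∀ i, r₀ =ᵐ[Q] r i ∨ Integrable (fun y => Real.log (r i y / r₀ y)) Q ∧
      ∫ y, Real.log (r i y / r₀ y) ∂Q < 0) :
    0 < iidLaw Q {s | ∀ t, ∑ i, u i * iidLik (r i) t s ≤ iidLik r₀ t s} := by
  classical
  obtain ⟨K, hK⟩ := exists_bound_iidLik_pos (fun i => ¬ r₀ =ᵐ[Q] r i) h₀ h h₀0 h0
    fun i hi => (hdich i).resolve_left hi
  set G : Set (ℕ → Y) :=
    {s | ∀ i, ¬ r₀ =ᵐ[Q] r i → ∀ t, iidLik (r i) t s ≤ K * iidLik r₀ t s} with hG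
  have mG : MeasurableSet G := by
    simp only [hG, Set.ofPred_forall]
    exact .iInter fun i => .iInter fun _ => .iInter fun t =>
      measurableSet_le (measurable_iidLik (h i) t) ((measurable_iidLik h₀ t).const_mul _)
  have hK1 : (0 : ℝ) < K + 1 := by positivity
  set U := ∑ i, u i with hU
  have hU1 : 0 < 1 - U := sub_pos.2 hu1
  -- `K` bounds growth after any time and is fixed before `T`, so `κ` may depend on it: a ratio at
  -- most `κ` at time `T` stays below `1 - U`. Using `K + 1` keeps the denominator positive.
  obtain ⟨T, B, mB, hB, hgood⟩ := exists_good_past_pos hu hu1 h₀ h h₀0 h0 h₀1 h1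
    (κ := (1 - U) / (K + 1)) (div_pos hU1 hK1)
  set C : Set (ℕ → Y) := (fun s j => s (T + j)) ⁻¹' G
  have mC : MeasurableSet[futureSigma Y T] C := measurable_shift_future T mG
  have hC : iidLaw Q C = iidLaw Q G := by
    conv_rhs => rw [← map_shift_iidLaw (Q := Q) T]
    rw [Measure.map_apply ((measurable_shift_future T).mono (futureSigma_le T) le_rfl) mG]
  -- A good past and a bounded shifted future are independent, so they occur together with positive
  -- probability.
  have hBC : 0 < iidLaw Q (B ∩ C) := by
    rw [(Indep_iff _ _ _).1 (indep_past_future T) _ _ mB mC, hC]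
    exact ENNReal.mul_pos hB.ne' hK.ne'
  have hH : ∀ᵐ s ∂(iidLaw Q), ∀ (j : ℕ) (i : ι), r₀ =ᵐ[Q] r i → r₀ (s j) = r i (s j) := by
    refine ae_all_iff.2 fun j => ae_all_iff.2 fun i => ?_
    by_cases hi : r₀ =ᵐ[Q] r i
    · have := (measurePreserving_eval_infinitePi (fun _ : ℕ => Q) j).quasiMeasurePreserving.ae hi
      filter_upwards [this] with s hs _
      exact hs
    · exact ae_of_all _ fun _ hi' => absurd hi' hi
  refine lt_of_lt_of_le hBC (measure_mono_ae ?_)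
  filter_upwards [hH] with s hs hmem t
  obtain ⟨hgt, hgk⟩ := hgood s hmem.1
  rcases le_or_gt t T with ht | ht
  · exact hgt t ht
  obtain ⟨τ, rfl⟩ := Nat.exists_eq_add_of_le ht.le
  have hL := iidLik_pos h₀0 T s
  have hR := iidLik_pos h₀0 τ fun j => s (T + j)
  have hLR := iidLik_pos h₀0 (T + τ) s
  have term : ∀ i, u i * iidLik (r i) (T + τ) s ≤
      u i * (if r₀ =ᵐ[Q] r i then 1 else 1 - U) * iidLik r₀ (T + τ) s := by
    intro i
    rw [mul_assoc]
    refine mul_le_mul_of_nonneg_left ?_ (hu i)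
    split_ifs with hi
    · rw [one_mul]
      exact (Finset.prod_congr rfl fun j _ => (hs j i hi).symm).le
    · rw [iidLik_add, iidLik_add]
      calc iidLik (r i) T s * iidLik (r i) τ (fun j => s (T + j))
          ≤ ((1 - U) / (K + 1) * iidLik r₀ T s) * (K * iidLik r₀ τ fun j => s (T + j)) :=
            mul_le_mul (hgk i hi) (hmem.2 i hi τ) (iidLik_pos (h0 i) _ _).le (by positivity)
        _ ≤ ((1 - U) / (K + 1) * iidLik r₀ T s) *
            ((K + 1) * iidLik r₀ τ fun j => s (T + j)) := by
            gcongr; linarith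
        _ = _ := by field_simp
  refine (Finset.sum_le_sum fun i _ => term i).trans ?_
  rw [← Finset.sum_mul]
  refine mul_le_of_le_one_left hLR.le (le_trans (Finset.sum_le_sum fun i _ => ?_) hu1.le)
  refine mul_le_of_le_one_right (hu i) ?_
  have : 0 ≤ U := Finset.sum_nonneg fun i _ => hu i
  split_ifs
  · exact le_rfl
  · linarith

end IidLikelihood

/-! ### Densities, the moment criterion and a variational functional -/

section Density

variable {X : Type*} [MeasurableSpace X] {ν : Measure X}

theorem integral_densityMeasure {f : X → ℝ} (hf : Measurable f) (hf0 : ∀ x, 0 ≤ f x) (g : X → ℝ) :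
    ∫ x, g x ∂(densityMeasure ν f) = ∫ x, f x * g x ∂ν := by
  rw [densityMeasure, integral_withDensity_eq_integral_toReal_smul hf.ennreal_ofReal
    (ae_of_all _ fun _ => ENNReal.ofReal_lt_top)]
  simp [ENNReal.toReal_ofReal (hf0 _)]

theorem integrable_densityMeasure_iff {f : X → ℝ} (hf : Measurable f) (hf0 : ∀ x, 0 ≤ f x)
    (g : X → ℝ) :
    Integrable g (densityMeasure ν f) ↔ Integrable (fun x => f x * g x) ν := by
  rw [densityMeasure, integrable_withDensity_iff_integrable_smul' hf.ennreal_ofReal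
    (ae_of_all _ fun _ => ENNReal.ofReal_lt_top)]
  simp [ENNReal.toReal_ofReal (hf0 _)]

theorem isProbabilityMeasure_densityMeasure {f : X → ℝ}
    (hf1 : ∫⁻ x, ENNReal.ofReal (f x) ∂ν = 1) : IsProbabilityMeasure (densityMeasure ν f) := by
  constructor
  rw [densityMeasure, withDensity_apply _ MeasurableSet.univ, Measure.restrict_univ, hf1]

/-- With `f` the true density, this turns each model's prediction into a probability density
relative to the true law, as the i.i.d. results require. -/
theorem lintegral_div_densityMeasure {f g : X → ℝ} (hf : Measurable f) (hf0 : ∀ x, 0 < f x)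
    (hg : Measurable g) (hg1 : ∫⁻ x, ENNReal.ofReal (g x) ∂ν = 1) :
    ∫⁻ x, ENNReal.ofReal (g x / f x) ∂(densityMeasure ν f) = 1 := by
  rw [densityMeasure, lintegral_withDensity_eq_lintegral_mul _ hf.ennreal_ofReal
    (hg.fun_div hf).ennreal_ofReal, ← hg1]
  refine lintegral_congr fun x => ?_
  rw [Pi.mul_apply, ← ENNReal.ofReal_mul (hf0 x).le, mul_div_cancel₀ _ (hf0 x).ne']

/-- If some positive moment of the ratio of `g` to `f` is at most one, then `g` either agrees
with `f` or has a strictly smaller expected logarithm. -/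
theorem ae_eq_or_integral_log_neg {Q : Measure X} [IsProbabilityMeasure Q] {f g : X → ℝ}
    (hf : Measurable f) (hg : Measurable g) (hf0 : ∀ x, 0 < f x) (hg0 : ∀ x, 0 < g x)
    (hint : Integrable (fun x => Real.log (g x / f x)) Q) {d : ℝ} (hd : 0 < d)
    (hmom : ∫⁻ x, ENNReal.ofReal ((g x / f x) ^ d) ∂Q ≤ 1) :
    f =ᵐ[Q] g ∨ ∫ x, Real.log (g x / f x) ∂Q < 0 := by
  refine or_iff_not_imp_right.2 fun hnn => ?_
  rw [not_lt] at hnn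
  have hm : Measurable fun x => (g x / f x) ^ d := (hg.div hf).pow_const d
  have hpos : ∀ x, 0 < (g x / f x) ^ d := fun x => Real.rpow_pos_of_pos (div_pos (hg0 x) (hf0 x)) d
  have hpint : Integrable (fun x => (g x / f x) ^ d) Q :=
    ⟨hm.aestronglyMeasurable, (hasFiniteIntegral_iff_ofReal (ae_of_all _ fun x => (hpos x).le)).2
      (hmom.trans_lt ENNReal.one_lt_top)⟩
  have hpow : ∀ x, (g x / f x) ^ d = Real.exp (d * Real.log (g x / f x)) := fun x => by
    rw [Real.rpow_def_of_pos (div_pos (hg0 x) (hf0 x)), mul_comm]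
  have hle : ∫ x, (g x / f x) ^ d ∂Q ≤ 1 := by
    rw [integral_eq_lintegral_of_nonneg_ae (ae_of_all _ fun x => (hpos x).le)
      hm.aestronglyMeasurable]
    exact ENNReal.toReal_le_of_le_ofReal zero_le_one (by simpa using hmom)
  -- This is `exp z ≥ 1 + z` with `z` equal to `d` times the log ratio. If the mean log ratio is
  -- nonnegative, the moment bound makes the integral of the gap at most zero, so the gap vanishes
  -- a.e.; equality holds only at `z = 0`.
  have hnonneg : ∀ x, 0 ≤ (g x / f x) ^ d - 1 - d * Real.log (g x / f x) := fun x => by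
    rw [hpow]
    linarith [Real.add_one_le_exp (d * Real.log (g x / f x))]
  have hint1 : Integrable (fun x => (g x / f x) ^ d - 1) Q := hpint.sub (integrable_const 1)
  have hzero : ∫ x, ((g x / f x) ^ d - 1 - d * Real.log (g x / f x)) ∂Q = 0 := by
    refine le_antisymm ?_ (integral_nonneg hnonneg)
    rw [integral_sub hint1 (hint.const_mul d), integral_sub hpint (integrable_const 1),
      integral_const_mul, integral_const, probReal_univ, one_smul]
    linarith [mul_nonneg hd.le hnn]
  have hae := (integral_eq_zero_iff_of_nonneg hnonneg (hint1.sub (hint.const_mul d))).1 hzero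
  filter_upwards [hae] with x hx
  have hlog : Real.log (g x / f x) = 0 := by
    by_contra hne
    have := Real.add_one_lt_exp (mul_ne_zero hd.ne' hne)
    rw [← hpow] at this
    simp only [Pi.zero_apply] at hx
    linarith
  have := Real.exp_log (div_pos (hg0 x) (hf0 x))
  rw [hlog, Real.exp_zero, eq_comm, div_eq_one_iff_eq (hf0 x).ne'] at this
  exact this.symm

theorem abs_exp_sub_exp_le {a b n : ℝ} (ha : a ≤ n) (hb : b ≤ n) :
    |Real.exp a - Real.exp b| ≤ Real.exp n * |a - b| := by
  have key : ∀ a b : ℝ, a ≤ n → b ≤ a → Real.exp a - Real.exp b ≤ Real.exp n * (a - b) := by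
    intro a b ha hba
    have h1 := Real.add_one_le_exp (b - a)
    have h2 : Real.exp b = Real.exp a * Real.exp (b - a) := by rw [← Real.exp_add]; ring_nf
    have h3 := Real.exp_le_exp.2 ha
    have h4 := Real.exp_pos a
    nlinarith
  rcases le_total b a with h | h
  · rw [abs_of_nonneg (sub_nonneg.2 (Real.exp_le_exp.2 h)), abs_of_nonneg (sub_nonneg.2 h)]
    exact key a b ha h
  · rw [abs_sub_comm, abs_sub_comm a, abs_of_nonneg (sub_nonneg.2 (Real.exp_le_exp.2 h)),
      abs_of_nonneg (sub_nonneg.2 h)]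
    exact key b a hb h

/-- The truncation of `x` to `[-n, n]`. -/
def clamp (n x : ℝ) : ℝ := max (-n) (min n x)

theorem continuous_clamp (n : ℝ) : Continuous (clamp n) := by unfold clamp; fun_prop

theorem clamp_le {n : ℝ} (hn : 0 ≤ n) (x : ℝ) : clamp n x ≤ n :=
  max_le (by linarith) (min_le_left _ _)

theorem neg_le_clamp (n x : ℝ) : -n ≤ clamp n x := le_max_left _ _

theorem abs_clamp_le {n : ℝ} (hn : 0 ≤ n) (x : ℝ) : |clamp n x| ≤ n :=
  abs_le.2 ⟨neg_le_clamp n x, clamp_le hn x⟩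

theorem clamp_of_abs_le {n x : ℝ} (h : |x| ≤ n) : clamp n x = x := by
  rw [clamp, min_eq_right (abs_le.1 h).2, max_eq_right (abs_le.1 h).1]

theorem abs_clamp_le_abs {n : ℝ} (hn : 0 ≤ n) (x : ℝ) : |clamp n x| ≤ |x| := by
  rcases le_total |x| n with h | h
  · rw [clamp_of_abs_le h]
  · exact (abs_clamp_le hn x).trans h

theorem abs_clamp_sub_clamp_le (n x y : ℝ) : |clamp n x - clamp n y| ≤ |x - y| := by
  unfold clamp
  refine (abs_max_sub_max_le_max _ _ _ _).trans (max_le (by simp) ?_)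
  exact (abs_min_sub_min_le_max _ _ _ _).trans (max_le (by simp) le_rfl)

/-- Provides the integrable dominating function for the truncated exponentials; the `1` covers
negative `x`, where truncation raises the exponential. -/
theorem exp_clamp_le {n : ℝ} (hn : 0 ≤ n) (x : ℝ) : Real.exp (clamp n x) ≤ Real.exp x + 1 := by
  rcases le_total x 0 with h | h
  · have : clamp n x ≤ 0 := max_le (by linarith) ((min_le_right _ _).trans h)
    linarith [Real.exp_le_one_iff.2 this, Real.exp_pos x]
  · have : clamp n x ≤ x := max_le (by linarith) (min_le_right _ _)
    linarith [Real.exp_le_exp.2 this]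

theorem tendsto_clamp (x : ℝ) : Tendsto (fun n : ℕ => clamp n x) atTop (𝓝 x) := by
  obtain ⟨N, hN⟩ := exists_nat_ge |x|
  refine tendsto_const_nhds.congr' ?_
  filter_upwards [eventually_ge_atTop N] with n hn
  exact (clamp_of_abs_le (hN.trans (Nat.cast_le.2 hn))).symm

/-- The variational functional `f ↦ ∫ f dQ - ∫ exp f dR` comes close to its value at an
integrable `h` along bounded continuous functions. -/
theorem exists_boundedContinuous_variational [TopologicalSpace X] [NormalSpace X] [BorelSpace X]
    {Q ρ : Measure X} [IsFiniteMeasure Q] [IsFiniteMeasure ρ] [(Q + ρ).WeaklyRegular]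
    {h : X → ℝ} (hm : Measurable h) (hQ : Integrable h Q)
    (hR : Integrable (fun x => Real.exp (h x)) ρ) {c : ℝ}
    (hc : c < ∫ x, h x ∂Q - ∫ x, Real.exp (h x) ∂ρ) :
    ∃ f e : BoundedContinuousFunction X ℝ, (∀ x, e x = Real.exp (f x)) ∧
      c < ∫ x, f x ∂Q - ∫ x, e x ∂ρ := by
  have lim1 : Tendsto (fun n : ℕ => ∫ x, clamp n (h x) ∂Q) atTop (𝓝 (∫ x, h x ∂Q)) := by
    refine tendsto_integral_of_dominated_convergence (fun x => |h x|) (fun n =>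
      ((continuous_clamp n).measurable.comp hm).aestronglyMeasurable) hQ.abs (fun n =>
      ae_of_all _ fun x => ?_) (ae_of_all _ fun x => tendsto_clamp _)
    exact abs_clamp_le_abs n.cast_nonneg _
  have lim2 : Tendsto (fun n : ℕ => ∫ x, Real.exp (clamp n (h x)) ∂ρ) atTop
      (𝓝 (∫ x, Real.exp (h x) ∂ρ)) := by
    refine tendsto_integral_of_dominated_convergence (fun x => Real.exp (h x) + 1) (fun n =>
      (Real.measurable_exp.comp ((continuous_clamp n).measurable.comp hm)).aestronglyMeasurable)
      (hR.add (integrable_const 1)) (fun n => ae_of_all _ fun x => ?_)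
      (ae_of_all _ fun x => (Real.continuous_exp.tendsto _).comp (tendsto_clamp _))
    rw [Real.norm_of_nonneg (Real.exp_pos _).le]
    exact exp_clamp_le n.cast_nonneg _
  obtain ⟨n, hn⟩ := ((lim1.sub lim2).eventually (lt_mem_nhds hc)).exists
  have hn0 : (0 : ℝ) ≤ n := n.cast_nonneg
  have mcl : Measurable fun x => clamp n (h x) := (continuous_clamp n).measurable.comp hm
  have hbd : ∀ (μ : Measure X) [IsFiniteMeasure μ], Integrable (fun x => clamp n (h x)) μ :=
    fun μ _ => Integrable.of_bound mcl.aestronglyMeasurable n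
      (ae_of_all _ fun x => abs_clamp_le hn0 _)
  set gap := ∫ x, clamp n (h x) ∂Q - ∫ x, Real.exp (clamp n (h x)) ∂ρ - c with hgap
  have hgap0 : 0 < gap := sub_pos.2 hn
  -- An `L¹` error in the exponent costs itself under `Q` and at most `exp n` times itself under
  -- `ρ`, so an error `η` for `Q + ρ` uses up only half of the gap.
  set η := gap / (2 * (1 + Real.exp n)) with hη
  have hη0 : 0 < η := by positivity
  obtain ⟨g, hg, hgi⟩ := (hbd (Q + ρ)).exists_boundedContinuous_integral_sub_le hη0
  have hgm : Measurable fun x => clamp n (g x) :=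
    (continuous_clamp n).measurable.comp g.continuous.measurable
  -- The approximant is truncated again: this does not increase its distance to the truncated `h`,
  -- and keeps it in the range where `exp` has Lipschitz constant `exp n`.
  let f : BoundedContinuousFunction X ℝ := BoundedContinuousFunction.ofNormedAddCommGroup
    (fun x => clamp n (g x)) ((continuous_clamp n).comp g.continuous) n
    fun x => abs_clamp_le hn0 _
  let e : BoundedContinuousFunction X ℝ := BoundedContinuousFunction.ofNormedAddCommGroup
    (fun x => Real.exp (clamp n (g x)))
    (Real.continuous_exp.comp ((continuous_clamp n).comp g.continuous)) (Real.exp n)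
    fun x => by
      rw [Real.norm_of_nonneg (Real.exp_pos _).le]
      exact Real.exp_le_exp.2 (clamp_le hn0 _)
  refine ⟨f, e, fun x => rfl, ?_⟩
  have hdiff : Integrable (fun x => |clamp n (h x) - g x|) (Q + ρ) := ((hbd (Q + ρ)).sub hgi).abs
  have hdQ := hdiff.mono_measure (Measure.le_add_right le_rfl : Q ≤ Q + ρ)
  have hdR := hdiff.mono_measure (Measure.le_add_left le_rfl : ρ ≤ Q + ρ)
  have hsum : ∫ x, |clamp n (h x) - g x| ∂Q + ∫ x, |clamp n (h x) - g x| ∂ρ ≤ η := by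
    rw [← integral_add_measure hdQ hdR]
    exact hg
  have hpt : ∀ x, |clamp n (h x) - clamp n (g x)| ≤ |clamp n (h x) - g x| := fun x => by
    conv_lhs => rw [← clamp_of_abs_le (abs_clamp_le hn0 (h x))]
    exact abs_clamp_sub_clamp_le _ _ _
  have fint : Integrable (fun x => f x) Q := f.integrable Q
  have eint : Integrable (fun x => e x) ρ := e.integrable ρ
  have cexp : Integrable (fun x => Real.exp (clamp n (h x))) ρ :=
    Integrable.of_bound (Real.measurable_exp.comp mcl).aestronglyMeasurable (Real.exp n)
      (ae_of_all _ fun x => by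
        rw [Real.norm_of_nonneg (Real.exp_pos _).le]
        exact Real.exp_le_exp.2 (clamp_le hn0 _))
  have b1 : ∫ x, clamp n (h x) ∂Q - ∫ x, f x ∂Q ≤ ∫ x, |clamp n (h x) - g x| ∂Q := by
    rw [← integral_sub (hbd Q) fint]
    exact integral_mono ((hbd Q).sub fint) hdQ fun x => (le_abs_self _).trans (hpt x)
  have b2 : ∫ x, e x ∂ρ - ∫ x, Real.exp (clamp n (h x)) ∂ρ ≤
      Real.exp n * ∫ x, |clamp n (h x) - g x| ∂ρ := by
    rw [← integral_sub eint cexp, ← integral_const_mul]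
    refine integral_mono (eint.sub cexp) (hdR.const_mul _) fun x => ?_
    refine (le_abs_self _).trans ?_
    rw [abs_sub_comm]
    refine (abs_exp_sub_exp_le (clamp_le hn0 _) (clamp_le hn0 _)).trans ?_
    exact mul_le_mul_of_nonneg_left (hpt x) (Real.exp_pos _).le
  have n1 : 0 ≤ ∫ x, |clamp n (h x) - g x| ∂Q := integral_nonneg fun _ => abs_nonneg _
  have n2 : 0 ≤ ∫ x, |clamp n (h x) - g x| ∂ρ := integral_nonneg fun _ => abs_nonneg _
  have hexp := Real.exp_pos (n : ℝ)
  have hηg : (1 + Real.exp n) * η = gap / 2 := by rw [hη]; field_simp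
  nlinarith

end Density

/-! ### Lower semicontinuity of the Kullback-Leibler divergence -/

section KullbackLeibler

variable {A : Type*} {n k : ℕ} {env : Environment A n}

theorem Model.integrable_log_ratio (θ : Model env k) (a : A) {ω : EuclideanSpace ℝ (Fin k)}
    (hω : ω ∈ θ.Ω) :
    Integrable (fun y => Real.log (env.qStar a y / θ.q a ω y)) (env.QStar a) := by
  obtain ⟨g, hg, hle⟩ := θ.log_ratio_bound a ω hω
  refine (hg.integrable one_le_two).mono' ?_ hle
  exact (Real.measurable_log.comp ((env.qStar_measurable a).div
    (θ.q_measurable a ω hω))).aestronglyMeasurable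

theorem Model.KL_eq (θ : Model env k) (a : A) (ω : θ.Ω) :
    θ.KL a ω = ∫ y, Real.log (env.qStar a y / θ.q a ω y) ∂(env.QStar a) := by
  rw [Environment.QStar, integral_densityMeasure (env.qStar_measurable a)
    fun y => (env.qStar_pos a y).le]
  rfl

/-- Lower semicontinuity of the Kullback-Leibler divergence in the parameter of the family. -/
theorem Family.exists_forall_lt_integral_log (F : Family env k) (a : A)
    {ω₀ : EuclideanSpace ℝ (Fin k)} (hω₀ : ω₀ ∈ F.Ωq) (hpos : ∀ y, 0 < F.q a ω₀ y)
    (hint : Integrable (fun y => Real.log (env.qStar a y / F.q a ω₀ y)) (env.QStar a)) {c : ℝ}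
    (hc : c < ∫ y, Real.log (env.qStar a y / F.q a ω₀ y) ∂(env.QStar a)) :
    ∃ ε > 0, ∀ ω ∈ F.Ωq, dist ω ω₀ < ε → (∀ y, 0 < F.q a ω y) →
      Integrable (fun y => Real.log (env.qStar a y / F.q a ω y)) (env.QStar a) →
      c < ∫ y, Real.log (env.qStar a y / F.q a ω y) ∂(env.QStar a) := by
  have mS := env.qStar_measurable a
  have pS := env.qStar_pos a
  have m₀ := F.q_measurable a ω₀ hω₀
  set ρ := densityMeasure env.ν (F.q a ω₀) with hRdef
  have : IsProbabilityMeasure ρ := isProbabilityMeasure_densityMeasure (F.q_mass a ω₀ hω₀)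
  have hexp : ∀ y, Real.exp (Real.log (env.qStar a y / F.q a ω₀ y)) =
      env.qStar a y / F.q a ω₀ y := fun y => Real.exp_log (div_pos (pS y) (hpos y))
  have hlint := lintegral_div_densityMeasure m₀ hpos mS (env.qStar_mass a)
  have hnn : 0 ≤ᵐ[ρ] fun y => env.qStar a y / F.q a ω₀ y :=
    ae_of_all _ fun y => (div_pos (pS y) (hpos y)).le
  have hRint : Integrable (fun y => env.qStar a y / F.q a ω₀ y) ρ :=
    ⟨(mS.div m₀).aestronglyMeasurable, (hasFiniteIntegral_iff_ofReal hnn).2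
      (by rw [hlint]; exact ENNReal.one_lt_top)⟩
  have hRone : ∫ y, env.qStar a y / F.q a ω₀ y ∂ρ = 1 := by
    rw [integral_eq_lintegral_of_nonneg_ae hnn (mS.div m₀).aestronglyMeasurable, hlint,
      ENNReal.toReal_one]
  -- The Donsker-Varadhan idea: at the true log ratio the functional equals the divergence minus
  -- one, so some bounded continuous `f` exceeds `c - 1`. For that fixed `f`, weak continuity of the
  -- family preserves the inequality near `ω₀`.
  obtain ⟨f, e, hfe, hlt⟩ := exists_boundedContinuous_variational (Q := env.QStar a) (ρ := ρ)
    (h := fun y => Real.log (env.qStar a y / F.q a ω₀ y)) (c := c - 1)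
    (Real.measurable_log.comp (mS.div m₀)) hint (by simpa only [hexp] using hRint)
    (by simp only [hexp, hRone]; linarith)
  have hReq : ∫ y, e y ∂ρ = ∫ y, e y * F.q a ω₀ y ∂env.ν := by
    rw [hRdef, integral_densityMeasure m₀ fun y => (hpos y).le]
    simp only [mul_comm]
  rw [hReq] at hlt
  have hev := ((F.q_continuous a e ω₀ hω₀).const_sub (∫ y, f y ∂(env.QStar a))).eventually
    (lt_mem_nhds hlt)
  obtain ⟨ε, hε, hball⟩ := Metric.mem_nhdsWithin_iff.1 hev
  refine ⟨ε, hε, fun ω hω hd hωpos hωint => ?_⟩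
  have hω' : c - 1 < ∫ y, f y ∂(env.QStar a) - ∫ y, e y * F.q a ω y ∂env.ν := hball ⟨hd, hω⟩
  have mω := F.q_measurable a ω hω
  have eq1 : ∫ y, e y * F.q a ω y ∂env.ν =
      ∫ y, e y * (F.q a ω y / env.qStar a y) ∂(env.QStar a) := by
    rw [Environment.QStar, integral_densityMeasure mS fun y => (pS y).le]
    refine integral_congr_ae (ae_of_all _ fun y => ?_)
    have := (pS y).ne'
    simp only
    field_simp
  have hratio : Integrable (fun y => F.q a ω y / env.qStar a y) (env.QStar a) := by
    have hnn : 0 ≤ᵐ[env.QStar a] fun y => F.q a ω y / env.qStar a y :=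
      ae_of_all _ fun y => (div_pos (hωpos y) (pS y)).le
    refine ⟨(mω.div mS).aestronglyMeasurable, (hasFiniteIntegral_iff_ofReal hnn).2 ?_⟩
    rw [Environment.QStar, lintegral_div_densityMeasure mS pS mω (F.q_mass a ω hω)]
    exact ENNReal.one_lt_top
  have heint : Integrable (fun y => e y * (F.q a ω y / env.qStar a y)) (env.QStar a) :=
    hratio.bdd_mul (c := ‖e‖) e.continuous.measurable.aestronglyMeasurable
      (ae_of_all _ fun y => e.norm_coe_le_norm y)
  have hfint : Integrable (fun y => f y) (env.QStar a) := f.integrable _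
  -- The easy half of the variational formula, valid at every `ω`: it integrates `log z ≤ z - 1` at
  -- `z = exp f` times the ratio of the predicted to the true density.
  have hmono : ∫ y, (f y - e y * (F.q a ω y / env.qStar a y) + 1) ∂(env.QStar a) ≤
      ∫ y, Real.log (env.qStar a y / F.q a ω y) ∂(env.QStar a) := by
    refine integral_mono ((hfint.sub heint).add (integrable_const 1)) hωint fun y => ?_
    have hx : 0 < F.q a ω y / env.qStar a y := div_pos (hωpos y) (pS y)
    have h1 := Real.log_le_sub_one_of_pos (mul_pos (Real.exp_pos (f y)) hx)
    rw [Real.log_mul (Real.exp_pos _).ne' hx.ne', Real.log_exp] at h1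
    have h2 : Real.log (env.qStar a y / F.q a ω y) = -Real.log (F.q a ω y / env.qStar a y) := by
      rw [← Real.log_inv, inv_div]
    simp only [hfe, h2]
    linarith
  have hsub : Integrable (fun y => f y - e y * (F.q a ω y / env.qStar a y)) (env.QStar a) :=
    hfint.sub heint
  rw [integral_add hsub (integrable_const 1), integral_sub hfint heint,
    integral_const, probReal_univ, one_smul, ← eq1] at hmono
  linarith

end KullbackLeibler

/-! ### Dynamic programming near a face of the belief simplex -/

namespace Model

variable {A : Type*} {n k : ℕ} {env : Environment A n}

/-- The expected flow payoff of an action under a parameter. -/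
noncomputable def payoff (θ : Model env k) (a : A) (ω : θ.Ω) : ℝ :=
  ∫ y, env.u a y * θ.q a ω y ∂env.ν

theorem continuous_bayes (θ : Model env k) (a : A) (y : env.Y) : Continuous (θ.bayes a y) := by
  refine Continuous.subtype_mk (continuous_pi fun ω => ?_) _
  have hc : ∀ ω : θ.Ω, Continuous fun π : θ.Belief => π.1 ω :=
    fun ω => (continuous_apply ω).comp continuous_subtype_val
  refine Continuous.div ((hc ω).mul_const _) (continuous_finsetSum _ fun ω' _ =>
    (hc ω').mul_const _) fun π => (θ.sum_belief_mul_q_pos a y π).ne'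

theorem measurable_bayes (θ : Model env k) (a : A) (π : θ.Belief) :
    Measurable fun y => θ.bayes a y π := by
  refine Measurable.subtype_mk (measurable_pi_lambda _ fun ω => ?_)
  exact ((θ.q_measurable a ω ω.2).const_mul _).div
    (Finset.measurable_fun_sum _ fun ω' _ => (θ.q_measurable a ω' ω'.2).const_mul _)

theorem integrable_q (θ : Model env k) (a : A) (ω : θ.Ω) :
    Integrable (θ.q a ω) env.ν :=
  ⟨(θ.q_measurable a ω ω.2).aestronglyMeasurable,
    (hasFiniteIntegral_iff_ofReal (ae_of_all _ fun y => (θ.q_pos a ω ω.2 y).le)).2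
      (by rw [θ.q_mass a ω ω.2]; exact ENNReal.one_lt_top)⟩

theorem integral_q (θ : Model env k) (a : A) (ω : θ.Ω) : ∫ y, θ.q a ω y ∂env.ν = 1 := by
  rw [integral_eq_lintegral_of_nonneg_ae (ae_of_all _ fun y => (θ.q_pos a ω ω.2 y).le)
    (θ.q_measurable a ω ω.2).aestronglyMeasurable, θ.q_mass a ω ω.2, ENNReal.toReal_one]

theorem integrable_u_mul_q (θ : Model env k) (a : A) (ω : θ.Ω) :
    Integrable (fun y => env.u a y * θ.q a ω y) env.ν := by
  have := (integrable_densityMeasure_iff (θ.q_measurable a ω ω.2)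
    (fun y => (θ.q_pos a ω ω.2 y).le) _).1 (θ.u_integrable a ω ω.2)
  simpa only [mul_comm] using this

theorem integrable_value_mul_q (θ : Model env k) (a : A) (ω : θ.Ω) (U : C(θ.Belief, ℝ))
    (π : θ.Belief) : Integrable (fun y => U (θ.bayes a y π) * θ.q a ω y) env.ν :=
  (θ.integrable_q a ω).bdd_mul (c := ‖U‖)
    (U.continuous.measurable.comp (θ.measurable_bayes a π)).aestronglyMeasurable
    (ae_of_all _ fun _ => U.norm_coe_le_norm _)

theorem objective_eq (θ : Model env k) (δ : ℝ) (U : C(θ.Belief, ℝ)) (π : θ.Belief) (a : A) :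
    θ.objective δ U π a = ∑ ω : θ.Ω, π.1 ω * θ.payoff a ω +
      δ * ∑ ω : θ.Ω, π.1 ω * ∫ y, U (θ.bayes a y π) * θ.q a ω y ∂env.ν := by
  rw [objective, Finset.mul_sum, ← Finset.sum_add_distrib]
  refine Finset.sum_congr rfl fun ω _ => ?_
  have : ∀ y, (env.u a y + δ * U (θ.bayes a y π)) * θ.q a ω y =
      env.u a y * θ.q a ω y + δ * (U (θ.bayes a y π) * θ.q a ω y) := fun y => by ring
  simp_rw [this]
  rw [integral_add (θ.integrable_u_mul_q a ω) ((θ.integrable_value_mul_q a ω U π).const_mul δ),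
    integral_const_mul, payoff]
  ring

theorem continuous_belief_apply (θ : Model env k) (ω : θ.Ω) :
    Continuous fun π : θ.Belief => π.1 ω :=
  (continuous_apply ω).comp continuous_subtype_val

theorem continuous_objective (θ : Model env k) (δ : ℝ) (U : C(θ.Belief, ℝ)) (a : A) :
    Continuous fun π => θ.objective δ U π a := by
  simp_rw [objective_eq]
  refine (continuous_finsetSum _ fun ω _ => (θ.continuous_belief_apply ω).mul_const _).add
    (continuous_const.mul (continuous_finsetSum _ fun ω _ =>
      (θ.continuous_belief_apply ω).mul ?_))
  refine continuous_of_dominated (bound := fun y => ‖U‖ * θ.q a ω y)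
    (fun π => (θ.integrable_value_mul_q a ω U π).aestronglyMeasurable)
    (fun π => ae_of_all _ fun y => ?_) ((θ.integrable_q a ω).const_mul _)
    (ae_of_all _ fun y => (U.continuous.comp (θ.continuous_bayes a y)).mul_const _)
  rw [norm_mul, Real.norm_of_nonneg (θ.q_pos a ω ω.2 y).le]
  exact mul_le_mul_of_nonneg_right (U.norm_coe_le_norm _) (θ.q_pos a ω ω.2 y).le

/-- Only continuation values at beliefs reachable by one update matter. This local form serves both
for the contraction on the whole simplex and for comparisons restricted to a face. -/
theorem objective_le_add (θ : Model env k) {δ : ℝ} (hδ : 0 ≤ δ) (U V : C(θ.Belief, ℝ))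
    (π : θ.Belief) (a : A) {D : ℝ} (h : ∀ y, U (θ.bayes a y π) ≤ V (θ.bayes a y π) + D) :
    θ.objective δ U π a ≤ θ.objective δ V π a + δ * D := by
  rw [objective_eq, objective_eq, add_assoc, ← mul_add]
  refine add_le_add le_rfl (mul_le_mul_of_nonneg_left ?_ hδ)
  have hD : D = ∑ ω : θ.Ω, π.1 ω * D := by rw [← Finset.sum_mul, π.2.2, one_mul]
  conv_rhs => rw [hD]
  rw [← Finset.sum_add_distrib]
  refine Finset.sum_le_sum fun ω _ => ?_
  rw [← mul_add]
  refine mul_le_mul_of_nonneg_left ?_ (π.2.1 ω)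
  have hD' : D = ∫ y, D * θ.q a ω y ∂env.ν := by rw [integral_const_mul, θ.integral_q, mul_one]
  conv_rhs => rw [hD']
  rw [← integral_add (θ.integrable_value_mul_q a ω V π) ((θ.integrable_q a ω).const_mul D)]
  refine integral_mono (θ.integrable_value_mul_q a ω U π)
    ((θ.integrable_value_mul_q a ω V π).add ((θ.integrable_q a ω).const_mul D)) fun y => ?_
  have := mul_le_mul_of_nonneg_right (h y) (θ.q_pos a ω ω.2 y).le
  simp only
  linarith

section Bellman

variable [Fintype A] [Nonempty A]

/-- The Bellman operator on continuous value functions. -/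
noncomputable def bellman (θ : Model env k) (δ : ℝ) (U : C(θ.Belief, ℝ)) : C(θ.Belief, ℝ) where
  toFun π := Finset.univ.sup' Finset.univ_nonempty fun a => θ.objective δ U π a
  continuous_toFun := Continuous.finset_sup'_apply _ fun a _ => θ.continuous_objective δ U a

theorem bellman_le_add (θ : Model env k) {δ : ℝ} (hδ : 0 ≤ δ) (U V : C(θ.Belief, ℝ))
    (π : θ.Belief) : θ.bellman δ U π ≤ θ.bellman δ V π + δ * dist U V := by
  refine Finset.sup'_le Finset.univ_nonempty _ fun a _ => ?_
  refine (θ.objective_le_add hδ U V π a (D := dist U V) fun y => ?_).trans ?_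
  · have := (abs_le.1 (ContinuousMap.dist_apply_le_dist (f := U) (g := V) (θ.bayes a y π))).2
    linarith
  · exact add_le_add
      (Finset.le_sup' (fun a => θ.objective δ V π a) (Finset.mem_univ a)) le_rfl

theorem contractingWith_bellman (θ : Model env k) {δ : ℝ} (hδ : 0 ≤ δ) (hδ1 : δ < 1) :
    ContractingWith ⟨δ, hδ⟩ (θ.bellman δ) := by
  refine ⟨NNReal.coe_lt_coe.1 hδ1, LipschitzWith.of_dist_le_mul fun U V => ?_⟩
  refine (ContinuousMap.dist_le (mul_nonneg hδ dist_nonneg)).2 fun π => ?_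
  rw [Real.dist_eq, abs_le]
  have h1 := θ.bellman_le_add hδ U V π
  have h2 := θ.bellman_le_add hδ V U π
  rw [dist_comm V U] at h2
  change -(δ * dist U V) ≤ _ ∧ _ ≤ δ * dist U V
  constructor <;> linarith

/-- The Banach fixed point of the Bellman operator. Continuity is what later extends strict
optimality from a face to nearby beliefs. -/
theorem exists_continuous_value (θ : Model env k) {δ : ℝ} (hδ : 0 ≤ δ) (hδ1 : δ < 1) :
    ∃ U : C(θ.Belief, ℝ), ∀ π, IsGreatest (Set.range (θ.objective δ U π)) (U π) := by
  refine ⟨(θ.contractingWith_bellman hδ hδ1).fixedPoint, fun π => ?_⟩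
  set U := (θ.contractingWith_bellman hδ hδ1).fixedPoint with hU
  have hfix : θ.bellman δ U = U := (θ.contractingWith_bellman hδ hδ1).fixedPoint_isFixedPt
  have hval : U π = Finset.univ.sup' Finset.univ_nonempty fun a => θ.objective δ U π a := by
    conv_lhs => rw [← hfix]
    rfl
  constructor
  · obtain ⟨a, -, ha⟩ := Finset.exists_mem_eq_sup' Finset.univ_nonempty
      fun a => θ.objective δ U π a
    exact ⟨a, by rw [hval, ha]⟩
  · rintro _ ⟨a, rfl⟩
    rw [hval]
    exact Finset.le_sup' (fun a => θ.objective δ U π a) (Finset.mem_univ a)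

end Bellman

/-- The discounted payoff of always playing `a`. -/
noncomputable def stationaryValue (θ : Model env k) (δ : ℝ) (a : A) : C(θ.Belief, ℝ) where
  toFun π := ∑ ω : θ.Ω, π.1 ω * (θ.payoff a ω / (1 - δ))
  continuous_toFun := continuous_finsetSum _ fun ω _ => (θ.continuous_belief_apply ω).mul_const _

/-- The stationary value is linear in the belief, and beliefs are a martingale under their own
predictive law; hence its expected continuation is its current value, whichever action is played. -/
theorem objective_stationaryValue (θ : Model env k) (δ : ℝ) (a b : A) (π : θ.Belief) :
    θ.objective δ (θ.stationaryValue δ a) π b =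
      ∑ ω : θ.Ω, π.1 ω * θ.payoff b ω + δ * θ.stationaryValue δ a π := by
  rw [objective_eq]
  congr 2
  simp_rw [← integral_const_mul]
  rw [← integral_finsetSum _ fun ω _ => (θ.integrable_value_mul_q b ω _ π).const_mul _]
  have pt : ∀ y, ∑ ω : θ.Ω, π.1 ω * (θ.stationaryValue δ a (θ.bayes b y π) * θ.q b ω y) =
      ∑ ω : θ.Ω, π.1 ω * (θ.payoff a ω / (1 - δ)) * θ.q b ω y := by
    intro y
    have hpos := (θ.sum_belief_mul_q_pos b y π).ne'
    have : ∀ ω : θ.Ω, π.1 ω * (θ.stationaryValue δ a (θ.bayes b y π) * θ.q b ω y) =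
        θ.stationaryValue δ a (θ.bayes b y π) * (π.1 ω * θ.q b ω y) := fun ω => by ring
    simp_rw [this]
    rw [← Finset.mul_sum]
    change (∑ ω : θ.Ω, π.1 ω * θ.q b ω y / (∑ ω' : θ.Ω, π.1 ω' * θ.q b ω' y) *
      (θ.payoff a ω / (1 - δ))) * _ = _
    rw [Finset.sum_mul]
    refine Finset.sum_congr rfl fun ω _ => ?_
    field_simp
  simp_rw [pt]
  rw [integral_finsetSum _ fun ω _ => (θ.integrable_q b ω).const_mul _]
  simp_rw [integral_const_mul, θ.integral_q, mul_one]
  rfl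

/-- Beliefs supported on `M`. -/
def face (θ : Model env k) (M : Set θ.Ω) : Set θ.Belief := {π | ∀ ω, π.1 ω ≠ 0 → ω ∈ M}

theorem isClosed_face (θ : Model env k) (M : Set θ.Ω) : IsClosed (θ.face M) := by
  have : θ.face M = ⋂ ω ∈ Mᶜ, {π | π.1 ω = 0} := by
    ext π
    simp only [face, Set.mem_ofPred_eq, Set.mem_iInter, Set.mem_compl_iff]
    exact forall_congr' fun ω => not_imp_comm
  rw [this]
  exact isClosed_biInter fun ω _ => isClosed_eq (θ.continuous_belief_apply ω) continuous_const

theorem bayes_mem_face {θ : Model env k} {M : Set θ.Ω} {π : θ.Belief} (h : π ∈ θ.face M) (a : A)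
    (y : env.Y) : θ.bayes a y π ∈ θ.face M := by
  intro ω hω
  refine h ω fun h0 => hω ?_
  change π.1 ω * θ.q a ω y / _ = 0
  rw [h0, zero_mul, zero_div]

theorem sum_mul_payoff_lt {θ : Model env k} {π : θ.Belief} {a b : A}
    (h : θ.myopicOptimal π = {a}) (hb : b ≠ a) :
    ∑ ω : θ.Ω, π.1 ω * θ.payoff b ω < ∑ ω : θ.Ω, π.1 ω * θ.payoff a ω := by
  have ha : a ∈ θ.myopicOptimal π := h ▸ rfl
  have hb' : b ∉ θ.myopicOptimal π := fun hb' => hb (by rw [h] at hb'; exact hb')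
  simp only [myopicOptimal, Set.mem_ofPred_eq, not_forall, not_le] at hb'
  obtain ⟨c, hc⟩ := hb'
  exact hc.trans_le (ha c)

/-- If `a` is the unique myopic optimum on a face of the simplex, then on that face it is
strictly optimal in the dynamic problem. -/
theorem objective_lt_of_mem_face {θ : Model env k} {δ : ℝ} (hδ : 0 ≤ δ) (hδ1 : δ < 1)
    {U : C(θ.Belief, ℝ)} (hU : ∀ π, IsGreatest (Set.range (θ.objective δ U π)) (U π))
    {M : Set θ.Ω} {a : A} (hM : ∀ π ∈ θ.face M, θ.myopicOptimal π = {a})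
    {π : θ.Belief} (hπ : π ∈ θ.face M) {b : A} (hb : b ≠ a) :
    θ.objective δ U π b < θ.objective δ U π a := by
  set V := θ.stationaryValue δ a with hV
  have hVeq : ∀ π, V π = ∑ ω : θ.Ω, π.1 ω * θ.payoff a ω + δ * V π := fun π => by
    have : V π * (1 - δ) = ∑ ω : θ.Ω, π.1 ω * θ.payoff a ω := by
      change (∑ ω : θ.Ω, π.1 ω * (θ.payoff a ω / (1 - δ))) * (1 - δ) = _
      rw [Finset.sum_mul]
      refine Finset.sum_congr rfl fun ω _ => ?_
      have : 1 - δ ≠ 0 := by linarith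
      field_simp
    linarith
  -- The largest gap `D` between `U` and the stationary value on the face is attained. Bayesian
  -- updates stay in the face, so `D ≤ δ * D`, which forces `U` and `V` to agree there and reduces
  -- the dynamic comparison to the myopic one.
  obtain ⟨π₀, hπ₀, hmax⟩ := (θ.isClosed_face M).isCompact.exists_isMaxOn ⟨π, hπ⟩
    (U - V).continuous.abs.continuousOn
  set D := |(U - V) π₀| with hD
  have hdist : ∀ π ∈ θ.face M, |U π - V π| ≤ D := fun π hπ => hmax hπ
  have step : |U π₀ - V π₀| ≤ δ * D := by
    have up : ∀ a', θ.objective δ U π₀ a' ≤ θ.objective δ V π₀ a' + δ * D := fun a' =>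
      θ.objective_le_add hδ U V π₀ a' fun y => by
        linarith [(abs_le.1 (hdist _ (bayes_mem_face hπ₀ a' y))).2]
    have dn : ∀ a', θ.objective δ V π₀ a' ≤ θ.objective δ U π₀ a' + δ * D := fun a' =>
      θ.objective_le_add hδ V U π₀ a' fun y => by
        linarith [(abs_le.1 (hdist _ (bayes_mem_face hπ₀ a' y))).1]
    have hVa : θ.objective δ V π₀ a = V π₀ := by
      rw [hV, objective_stationaryValue]; exact (hVeq π₀).symm
    have hVle : ∀ a', θ.objective δ V π₀ a' ≤ V π₀ := fun a' => by
      by_cases h : a' = a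
      · rw [h, hVa]
      · rw [hVeq, hV, objective_stationaryValue]
        linarith [sum_mul_payoff_lt (hM π₀ hπ₀) h]
    obtain ⟨a', ha'⟩ := (hU π₀).1
    have hle := (hU π₀).2 ⟨a, rfl⟩
    rw [abs_le]
    constructor
    · linarith [dn a]
    · linarith [up a', hVle a']
  have hD0 : D ≤ 0 := by
    have h1 : D ≤ δ * D := step
    nlinarith
  have heq : ∀ a', θ.objective δ U π a' = θ.objective δ V π a' := fun a' => by
    have e : ∀ y, U (θ.bayes a' y π) = V (θ.bayes a' y π) := fun y => by
      have := (hdist _ (bayes_mem_face hπ a' y)).trans hD0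
      linarith [abs_nonpos_iff.1 this]
    refine le_antisymm ?_ ?_
    · simpa using θ.objective_le_add hδ U V π a' (D := 0) fun y => by rw [e, add_zero]
    · simpa using θ.objective_le_add hδ V U π a' (D := 0) fun y => by rw [e, add_zero]
  rw [heq, heq, hV, objective_stationaryValue, objective_stationaryValue]
  linarith [sum_mul_payoff_lt (hM π hπ) hb]

/-- A continuous objective has a measurable selection of maximizers. -/
theorem exists_measurable_argmax [Finite A] [Nonempty A] {X : Type*} [TopologicalSpace X]
    [MeasurableSpace X] [OpensMeasurableSpace X] {J : X → A → ℝ}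
    (hJ : ∀ a, Continuous fun x => J x a) :
    ∃ sel : X → A, (∀ a, MeasurableSet (sel ⁻¹' {a})) ∧ ∀ x b, J x b ≤ J x (sel x) := by
  have := Fintype.ofFinite A
  obtain ⟨e, he⟩ := Countable.exists_injective_nat A
  -- Ties are broken by the least index, so each fibre of the selection is a countable Boolean
  -- combination of closed sets.
  have hex : ∀ x, ∃ a, (∀ b, J x b ≤ J x a) ∧ ∀ a', (∀ b, J x b ≤ J x a') → e a ≤ e a' := by
    classical
    intro x
    obtain ⟨a₀, ha₀⟩ := Finite.exists_max (J x)
    obtain ⟨a, ha, hmin⟩ := Finset.exists_min_image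
      (Finset.univ.filter fun a => ∀ b, J x b ≤ J x a) e ⟨a₀, by simpa using ha₀⟩
    exact ⟨a, (Finset.mem_filter.1 ha).2, fun a' h => hmin a' (by simpa using h)⟩
  choose sel hmax hmin using hex
  refine ⟨sel, fun a => ?_, hmax⟩
  have hclosed : ∀ a, MeasurableSet {x | ∀ b, J x b ≤ J x a} := fun a => by
    simp only [Set.ofPred_forall]
    exact .iInter fun b => (isClosed_le (hJ b) (hJ a)).measurableSet
  have : sel ⁻¹' {a} = {x | ∀ b, J x b ≤ J x a} ∩
      ⋂ a' ∈ {a' | e a' < e a}, {x | ∀ b, J x b ≤ J x a'}ᶜ := by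
    ext x
    simp only [Set.mem_preimage, Set.mem_singleton_iff, Set.mem_inter_iff, Set.mem_iInter,
      Set.mem_compl_iff, Set.mem_ofPred_eq]
    constructor
    · rintro rfl
      exact ⟨hmax x, fun a' h h' => absurd (hmin x a' h') (not_le.2 h)⟩
    · rintro ⟨h1, h2⟩
      refine he (le_antisymm (hmin x a h1) (not_lt.1 fun h => h2 _ h (hmax x)))
  rw [this]
  exact (hclosed a).inter (.biInter (Set.to_countable _) fun a' _ => (hclosed a').compl)

/-- If `a` is the unique myopic optimum on a nonempty face of the simplex, then some optimal policy
plays `a` at all beliefs close to that face. -/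
theorem exists_optimalPolicy_near_face [Finite A] (θ : Model env k) {δ : ℝ} (hδ : 0 ≤ δ)
    (hδ1 : δ < 1) {M : Set θ.Ω} {a : A} (hM : ∀ π ∈ θ.face M, θ.myopicOptimal π = {a}) :
    ∃ pol, θ.IsOptimalPolicy δ pol ∧ ∃ c > 0, ∀ π : θ.Belief,
      ∑ ω, Mᶜ.indicator π.1 ω < c → pol π = a := by
  have := Fintype.ofFinite A
  have : Nonempty A := ⟨a⟩
  obtain ⟨U, hU⟩ := θ.exists_continuous_value hδ hδ1
  obtain ⟨pol, hmeas, hopt⟩ := exists_measurable_argmax (θ.continuous_objective δ U)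
  refine ⟨pol, ⟨hmeas, U, ⟨U.continuous.measurable, ⟨‖U‖, fun π => U.norm_coe_le_norm π⟩, hU⟩,
    hopt⟩, ?_⟩
  set w : θ.Belief → ℝ := fun π => ∑ ω, Mᶜ.indicator π.1 ω with hw
  have hwc : Continuous w := by
    refine continuous_finsetSum _ fun ω _ => ?_
    by_cases h : ω ∈ Mᶜ
    · simpa only [Set.indicator_of_mem h] using θ.continuous_belief_apply ω
    · simpa only [Set.indicator_of_notMem h] using continuous_const
  -- The beliefs at which some other action does at least as well as `a`. This set is compact and
  -- misses the face, so the mass outside `M` has a positive minimum on it, which serves as `c`.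
  set K : Set θ.Belief := ⋃ b ∈ {b | b ≠ a}, {π | θ.objective δ U π a ≤ θ.objective δ U π b}
  have hK : IsClosed K := (Set.toFinite _).isClosed_biUnion fun b _ =>
    isClosed_le (θ.continuous_objective δ U a) (θ.continuous_objective δ U b)
  have hpol : ∀ π, π ∉ K → pol π = a := fun π h => by
    by_contra hne
    exact h (Set.mem_biUnion (x := pol π) hne (hopt π a))
  rcases K.eq_empty_or_nonempty with h | h
  · exact ⟨1, one_pos, fun π _ => hpol π (h ▸ Set.notMem_empty _)⟩
  obtain ⟨π₁, hπ₁, hmin⟩ := hK.isCompact.exists_isMinOn h hwc.continuousOn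
  refine ⟨w π₁, ?_, fun π hlt => hpol π fun hmem => absurd (hmin hmem) (not_le.2 hlt)⟩
  have hnn : ∀ ω ∈ (Finset.univ : Finset θ.Ω), 0 ≤ Mᶜ.indicator π₁.1 ω :=
    fun ω _ => Set.indicator_nonneg (fun ω _ => π₁.2.1 ω) ω
  refine (Finset.sum_nonneg hnn).lt_of_ne' fun h0 => ?_
  have hface : π₁ ∈ θ.face M := fun ω hω => by
    by_contra hn
    have := (Finset.sum_eq_zero_iff_of_nonneg hnn).1 h0 ω (Finset.mem_univ ω)
    rw [Set.indicator_of_mem (show ω ∈ Mᶜ from hn)] at this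
    exact hω this
  obtain ⟨b, hb, hle⟩ := Set.mem_iUnion₂.1 hπ₁
  exact absurd (objective_lt_of_mem_face hδ hδ1 hU hM hface hb) (not_lt.2 hle)

end Model

/-! ### Persistence along the path on which one action is always played -/

/-- The history, most recent first, in which `a` is always played and the outcomes are `y`. -/
def constHistory {A X : Type*} (a : A) (y : ℕ → X) : ℕ → List (A × X)
  | 0 => []
  | t + 1 => (a, y t) :: constHistory a y t

variable {A : Type*} {n k : ℕ} {env : Environment A n}

namespace Model

theorem likelihood_pos (θ : Model env k) (π : θ.Belief) (h : List (A × env.Y)) :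
    0 < θ.likelihood π h := by
  have hprod : ∀ ω : θ.Ω, 0 < (h.map fun p => θ.q p.1 ω p.2).prod := fun ω => by
    refine List.prod_pos fun x hx => ?_
    obtain ⟨p, -, rfl⟩ := List.mem_map.1 hx
    exact θ.q_pos _ _ ω.2 _
  obtain ⟨ω, -, hω⟩ : ∃ ω ∈ (Finset.univ : Finset θ.Ω), 0 < π.1 ω := by
    apply Finset.exists_lt_of_sum_lt
    rw [Finset.sum_const_zero, π.2.2]
    exact one_pos
  exact Finset.sum_pos' (fun i _ => mul_nonneg (π.2.1 i) (hprod i).le)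
    ⟨ω, Finset.mem_univ _, mul_pos hω (hprod ω)⟩

theorem posterior_apply (θ : Model env k) (π : θ.Belief) (h : List (A × env.Y)) (ω : θ.Ω) :
    (θ.posterior π h).1 ω =
      π.1 ω * (h.map fun p => θ.q p.1 ω p.2).prod / θ.likelihood π h := by
  induction h generalizing ω with
  | nil =>
    simp only [posterior, likelihood, List.map_nil, List.prod_nil, mul_one]
    rw [π.2.2, div_one]
  | cons p h ih =>
    have hL := (θ.likelihood_pos π h).ne'
    change (θ.posterior π h).1 ω * θ.q p.1 ω p.2 /
      (∑ ω' : θ.Ω, (θ.posterior π h).1 ω' * θ.q p.1 ω' p.2) = _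
    have hnum : ∀ ω : θ.Ω, (θ.posterior π h).1 ω * θ.q p.1 ω p.2 =
        π.1 ω * ((p :: h).map fun p => θ.q p.1 ω p.2).prod / θ.likelihood π h := fun ω => by
      rw [ih, List.map_cons, List.prod_cons]
      ring
    simp_rw [hnum]
    rw [← Finset.sum_div, div_div_div_cancel_right₀ hL]
    rfl

theorem prod_map_constHistory (θ : Model env k) (a : A) (y : ℕ → env.Y) (t : ℕ)
    (ω : EuclideanSpace ℝ (Fin k)) :
    ((constHistory a y t).map fun p => θ.q p.1 ω p.2).prod = iidLik (θ.q a ω) t y := by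
  induction t with
  | zero => simp [constHistory, iidLik]
  | succ t ih => rw [constHistory, List.map_cons, List.prod_cons, ih, iidLik_succ, mul_comm]

theorem likelihood_constHistory (θ : Model env k) (π : θ.Belief) (a : A) (y : ℕ → env.Y) (t : ℕ) :
    θ.likelihood π (constHistory a y t) = ∑ ω : θ.Ω, π.1 ω * iidLik (θ.q a ω) t y := by
  simp only [likelihood, prod_map_constHistory]

/-- A belief that puts nearly all its mass on `ω₀` and has full support. -/
theorem exists_fullSupport_concentrated (θ : Model env k) (ω₀ : θ.Ω) {η : ℝ} (hη : 0 < η)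
    (hη1 : η < 1) :
    ∃ π : θ.Belief, θ.FullSupport π ∧ 1 - η ≤ π.1 ω₀ := by
  classical
  have hcard : (0 : ℝ) < Fintype.card θ.Ω := Nat.cast_pos.2 (Fintype.card_pos_iff.2 ⟨ω₀⟩)
  have hsmall : 0 < η / Fintype.card θ.Ω := div_pos hη hcard
  have hnn : ∀ ω, 0 ≤ (if ω = ω₀ then 1 - η else 0 : ℝ) := fun ω => by
    split_ifs
    · linarith
    · exact le_rfl
  refine ⟨⟨fun ω => (if ω = ω₀ then 1 - η else 0) + η / Fintype.card θ.Ω,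
    fun ω => add_nonneg (hnn ω) hsmall.le, ?_⟩, fun ω => add_pos_of_nonneg_of_pos (hnn ω) hsmall,
    ?_⟩
  · rw [Finset.sum_add_distrib, Finset.sum_ite_eq' Finset.univ ω₀, if_pos (Finset.mem_univ _),
      Finset.sum_const, Finset.card_univ, nsmul_eq_mul, mul_div_cancel₀ _ hcard.ne']
    ring
  · simp only [if_true]
    linarith

/-- The expected log-likelihood ratio is the difference of the Kullback-Leibler divergences. -/
theorem log_ratio_integrable_and_eq (θ θ' : Model env k) (a : A) (ω : θ.Ω) (ω' : θ'.Ω) :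
    Integrable (fun y => Real.log (θ'.q a ω' y / env.qStar a y / (θ.q a ω y / env.qStar a y)))
      (env.QStar a) ∧
    ∫ y, Real.log (θ'.q a ω' y / env.qStar a y / (θ.q a ω y / env.qStar a y)) ∂(env.QStar a) =
      θ.KL a ω - θ'.KL a ω' := by
  have e : ∀ y, Real.log (θ'.q a ω' y / env.qStar a y / (θ.q a ω y / env.qStar a y)) =
      Real.log (env.qStar a y / θ.q a ω y) - Real.log (env.qStar a y / θ'.q a ω' y) := fun y => by
    have h1 := θ.q_pos a ω ω.2 y
    have h2 := θ'.q_pos a ω' ω'.2 y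
    have h3 := env.qStar_pos a y
    rw [← Real.log_div (div_pos h3 h1).ne' (div_pos h3 h2).ne']
    congr 1
    field_simp
  simp_rw [e]
  have i1 := θ.integrable_log_ratio a ω.2
  have i2 := θ'.integrable_log_ratio a ω'.2
  exact ⟨i1.sub i2, by rw [integral_sub i1 i2, KL_eq, KL_eq]⟩

end Model

/-- If the competing model's likelihood never exceeds `α` times that of the initial model while
`a` is always played, and the initial model's policy then always prescribes `a`, the initial
model is always kept. -/
theorem history_eq_constHistory {θ θ' : Model env k} {π : θ.Belief} {π' : θ'.Belief}
    {pol : θ.Belief → A} {pol' : θ'.Belief → A} {α : ℝ} {a : A} {s : A × ℕ → env.Y}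
    (hlik : ∀ t, θ'.likelihood π' (constHistory a (fun τ => s (a, τ)) t) ≤
      α * θ.likelihood π (constHistory a (fun τ => s (a, τ)) t))
    (hpol : ∀ t, pol (θ.posterior π (constHistory a (fun τ => s (a, τ)) t)) = a) (t : ℕ) :
    (mkSwitcher θ θ' π π' pol pol').history α s t = constHistory a (fun τ => s (a, τ)) t ∧
      (mkSwitcher θ θ' π π' pol pol').choice α (constHistory a (fun τ => s (a, τ)) t) =
        Slot.initial := by
  set S := mkSwitcher θ θ' π π' pol pol' with hS
  set y : ℕ → env.Y := fun τ => s (a, τ) with hy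
  induction t with
  | zero => exact ⟨rfl, rfl⟩
  | succ t ih =>
    have hact : S.action α (constHistory a y t) = a := by
      rw [Switcher.action, ih.2]
      exact hpol t
    refine ⟨?_, ?_⟩
    · rw [Switcher.history, ih.1, hact]
      rfl
    · rw [constHistory, Switcher.choice, ih.2]
      refine if_neg (not_lt.2 ?_)
      exact (div_le_iff₀ (θ.likelihood_pos π _)).2 (hlik (t + 1))

/-- Restricting the potential outcomes to one action gives i.i.d. data, so an event about such data
can be pulled back to the switcher's probability space. -/
theorem measurePreserving_outcomes (env : Environment A n) (a : A) :
    MeasurePreserving (fun (s : A × ℕ → env.Y) (t : ℕ) => s (a, t)) env.outcomeLaw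
      (iidLaw (env.QStar a)) :=
  ⟨measurable_pi_lambda _ fun t => measurable_pi_apply (a, t),
    Measure.map_infinitePi_infinitePi_of_inj (P := fun p : A × ℕ => env.QStar p.1)
      (f := fun t : ℕ => (a, t)) fun _ _ h => (Prod.mk.inj h).2⟩

theorem iidLik_div {X : Type*} (f g : X → ℝ) (t : ℕ) (s : ℕ → X) :
    iidLik (fun x => f x / g x) t s = iidLik f t s / iidLik g t s :=
  Finset.prod_div_distrib _ _

/-- Persistence, when each parameter of the competing model is either indistinguishable from `ω₀`
or has a larger divergence than `ω₀`. -/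
theorem persistsAgainst_of_dichotomy {α : ℝ} (hα : 0 < α) {θ θ' : Model env k} {π : θ.Belief}
    (π' : θ'.Belief) {pol : θ.Belief → A} (pol' : θ'.Belief → A) {a : A} {M : Set θ.Ω} {ω₀ : θ.Ω}
    {c η : ℝ} (hc : 0 < c) (hη1 : η < 1) (hπ : 1 - η ≤ π.1 ω₀)
    (hω₀ : ω₀ ∈ M) (hM : ∀ ω ∉ M, θ.KL a ω₀ < θ.KL a ω)
    (hbudget : α⁻¹ + η / c < 1 - η)
    (hpol : ∀ π : θ.Belief, ∑ ω, Mᶜ.indicator π.1 ω ≤ c → pol π = a)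
    (hdich : ∀ ω' : θ'.Ω, (fun y => θ.q a ω₀ y / env.qStar a y) =ᵐ[env.QStar a]
      (fun y => θ'.q a ω' y / env.qStar a y) ∨ θ.KL a ω₀ < θ'.KL a ω') :
    PersistsAgainst α θ θ' π π' pol pol' := by
  have mS := env.qStar_measurable a
  have pS := env.qStar_pos a
  have hη0 : 0 < 1 - η := sub_pos.2 hη1
  set N : Set θ.Ω := Mᶜ
  have hout : ∑ ω, N.indicator π.1 ω ≤ η := by
    have hle : π.1 ω₀ + ∑ ω, N.indicator π.1 ω ≤ ∑ ω, π.1 ω := by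
      classical
      rw [← Finset.add_sum_erase _ _ (Finset.mem_univ ω₀),
        ← Finset.add_sum_erase _ π.1 (Finset.mem_univ ω₀),
        Set.indicator_of_notMem (fun h : ω₀ ∈ Mᶜ => h hω₀), zero_add]
      refine add_le_add le_rfl (Finset.sum_le_sum fun ω _ => ?_)
      exact Set.indicator_le_self' (fun _ _ => π.2.1 _) ω
    rw [π.2.2] at hle
    linarith
  -- Densities are taken relative to the true one; the common factor cancels from every likelihood
  -- comparison.
  let r₀ : env.Y → ℝ := fun y => θ.q a ω₀ y / env.qStar a y
  let r : θ'.Ω ⊕ {ω : θ.Ω // ω ∈ N} → env.Y → ℝ :=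
    Sum.elim (fun ω' y => θ'.q a ω' y / env.qStar a y) fun ω y => θ.q a ω y / env.qStar a y
  classical
  -- The weights encode both requirements. The initial likelihood is at least `1 - η` times that of
  -- `ω₀`, so the first block alone bounds the Bayes factor by `α` and the second alone bounds the
  -- posterior mass outside `M` by `c`.
  let u : θ'.Ω ⊕ {ω : θ.Ω // ω ∈ N} → ℝ :=
    Sum.elim (fun ω' => π'.1 ω' / ((1 - η) * α)) fun ω => π.1 ω / ((1 - η) * c)
  have hsub : ∀ f : θ.Ω → ℝ, ∑ ω : {ω : θ.Ω // ω ∈ N}, f ω = ∑ ω, N.indicator f ω := fun f => by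
    simp_rw [Set.indicator_apply]
    rw [← Finset.sum_filter]
    exact (Finset.sum_subtype _ (by simp) f).symm
  have hu : ∀ i, 0 ≤ u i := by
    rintro (ω' | ω)
    · exact div_nonneg (π'.2.1 _) (mul_pos hη0 hα).le
    · exact div_nonneg (π.2.1 _) (mul_pos hη0 hc).le
  have hu1 : ∑ i, u i < 1 := by
    rw [Fintype.sum_sum_type]
    simp only [u, Sum.elim_inl, Sum.elim_inr]
    rw [← Finset.sum_div, ← Finset.sum_div, hsub, π'.2.2]
    calc 1 / ((1 - η) * α) + (∑ ω, N.indicator π.1 ω) / ((1 - η) * c)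
        ≤ 1 / ((1 - η) * α) + η / ((1 - η) * c) := by gcongr
      _ = (α⁻¹ + η / c) / (1 - η) := by field_simp
      _ < 1 := (div_lt_one hη0).2 hbudget
  have mass : ∀ (θ : Model env k) (ω : θ.Ω),
      ∫⁻ y, ENNReal.ofReal (θ.q a ω y / env.qStar a y) ∂(env.QStar a) = 1 := fun θ ω =>
    lintegral_div_densityMeasure mS pS (θ.q_measurable a ω ω.2) (θ.q_mass a ω ω.2)
  have key := iidLaw_mixture_le_pos (Q := env.QStar a) (r₀ := r₀) (r := r) hu hu1
    ((θ.q_measurable a ω₀ ω₀.2).div mS)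
    (by
      rintro (ω' | ω)
      · exact (θ'.q_measurable a ω' ω'.2).div mS
      · exact (θ.q_measurable a ω ω.1.2).div mS)
    (fun y => div_pos (θ.q_pos a ω₀ ω₀.2 y) (pS y))
    (by
      rintro (ω' | ω) y
      · exact div_pos (θ'.q_pos a ω' ω'.2 y) (pS y)
      · exact div_pos (θ.q_pos a ω ω.1.2 y) (pS y))
    (mass θ ω₀)
    (by
      rintro (ω' | ω)
      · exact mass θ' ω'
      · exact mass θ ω)
    (by
      rintro (ω' | ω)
      · refine (hdich ω').imp id fun h => ?_
        have := θ.log_ratio_integrable_and_eq θ' a ω₀ ω'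
        exact ⟨this.1, this.2.trans_lt (sub_neg.2 h)⟩
      · have := θ.log_ratio_integrable_and_eq θ a ω₀ ω
        exact Or.inr ⟨this.1, this.2.trans_lt (sub_neg.2 (hM ω ω.2))⟩)
  have hle := (measurePreserving_outcomes env a).map_eq ▸ key
  refine lt_of_lt_of_le (hle.trans_le (le_of_eq (Measure.map_apply
    (measurePreserving_outcomes env a).measurable ?_))) (measure_mono fun s hs => ?_)
  · simp only [Set.ofPred_forall]
    refine .iInter fun t => measurableSet_le (Finset.measurable_fun_sum _ fun i _ =>
      (measurable_iidLik ?_ t).const_mul _) (measurable_iidLik ?_ t)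
    · rcases i with ω' | ω
      · exact (θ'.q_measurable a ω' ω'.2).div mS
      · exact (θ.q_measurable a ω ω.1.2).div mS
    · exact (θ.q_measurable a ω₀ ω₀.2).div mS
  set y : ℕ → env.Y := fun τ => s (a, τ) with hy
  have bound : ∀ t, θ'.likelihood π' (constHistory a y t) / ((1 - η) * α) +
      (∑ ω, N.indicator (fun ω => π.1 ω * iidLik (θ.q a ω) t y) ω) / ((1 - η) * c) ≤
        iidLik (θ.q a ω₀) t y := by
    intro t
    have h := hs t
    have hq := iidLik_pos pS t y
    rw [Fintype.sum_sum_type] at h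
    simp only [r, r₀, u, Sum.elim_inl, Sum.elim_inr, iidLik_div] at h
    rw [le_div_iff₀ hq] at h
    refine le_trans (le_of_eq ?_) h
    rw [θ'.likelihood_constHistory, ← hsub, add_mul, Finset.sum_mul, Finset.sum_mul,
      Finset.sum_div, Finset.sum_div]
    congr 1 <;> refine Finset.sum_congr rfl fun ω _ => ?_ <;>
      rw [mul_assoc, div_mul_cancel₀ _ hq.ne', div_mul_eq_mul_div]
  have hlow : ∀ t, (1 - η) * iidLik (θ.q a ω₀) t y ≤ θ.likelihood π (constHistory a y t) := by
    intro t
    rw [θ.likelihood_constHistory]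
    refine (mul_le_mul_of_nonneg_right hπ (iidLik_pos (θ.q_pos a ω₀ ω₀.2) t y).le).trans ?_
    exact Finset.single_le_sum (f := fun ω : θ.Ω => π.1 ω * iidLik (θ.q a ω) t y)
      (fun ω _ => mul_nonneg (π.2.1 ω) (iidLik_pos (θ.q_pos a ω ω.2) t y).le) (Finset.mem_univ ω₀)
  have hNnn : ∀ t, 0 ≤ ∑ ω, N.indicator (fun ω => π.1 ω * iidLik (θ.q a ω) t y) ω := fun t =>
    Finset.sum_nonneg fun ω _ => Set.indicator_nonneg
      (fun ω _ => mul_nonneg (π.2.1 ω) (iidLik_pos (θ.q_pos a ω ω.2) t y).le) ω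
  have hstay := history_eq_constHistory (π := π) (π' := π') (pol := pol) (pol' := pol') (α := α)
    (a := a) (s := s) (fun t => ?_) fun t => hpol _ ?_
  · exact ⟨0, fun t _ => by rw [(hstay t).1, (hstay t).2]⟩
  · have h1 : θ'.likelihood π' (constHistory a y t) / ((1 - η) * α) ≤ iidLik (θ.q a ω₀) t y :=
      le_trans (le_add_of_nonneg_right (div_nonneg (hNnn t) (mul_pos hη0 hc).le)) (bound t)
    rw [div_le_iff₀ (mul_pos hη0 hα)] at h1
    calc _ ≤ α * ((1 - η) * iidLik (θ.q a ω₀) t y) := by linarith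
      _ ≤ _ := mul_le_mul_of_nonneg_left (hlow t) hα.le
  · have h2 : (∑ ω, N.indicator (fun ω => π.1 ω * iidLik (θ.q a ω) t y) ω) / ((1 - η) * c) ≤
        iidLik (θ.q a ω₀) t y :=
      le_trans (le_add_of_nonneg_left (div_nonneg (θ'.likelihood_pos π' _).le
        (mul_pos hη0 hα).le)) (bound t)
    rw [div_le_iff₀ (mul_pos hη0 hc)] at h2
    have e : ∑ ω, N.indicator (θ.posterior π (constHistory a y t)).1 ω =
        (∑ ω, N.indicator (fun ω => π.1 ω * iidLik (θ.q a ω) t y) ω) /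
          θ.likelihood π (constHistory a y t) := by
      rw [Finset.sum_div]
      refine Finset.sum_congr rfl fun ω _ => ?_
      by_cases h : ω ∈ N
      · rw [Set.indicator_of_mem h, Set.indicator_of_mem h, θ.posterior_apply,
          θ.prod_map_constHistory]
      · rw [Set.indicator_of_notMem h, Set.indicator_of_notMem h, zero_div]
    rw [e, div_le_iff₀ (θ.likelihood_pos π _)]
    calc _ ≤ c * ((1 - η) * iidLik (θ.q a ω₀) t y) := by linarith
      _ ≤ _ := mul_le_mul_of_nonneg_left (hlow t) hc.le

theorem exists_dist_le_of_hausdorffDist_le {X : Type*} [MetricSpace X] {s t : Finset X}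
    (hs : s.Nonempty) {ε : ℝ} (h : Metric.hausdorffDist (s : Set X) t ≤ ε) {y : X} (hy : y ∈ t) :
    ∃ x ∈ s, dist y x ≤ ε := by
  have hfin : Metric.hausdorffEDist (t : Set X) s ≠ ⊤ :=
    Metric.hausdorffEDist_ne_top_of_nonempty_of_bounded ⟨y, hy⟩ hs
      t.finite_toSet.isBounded s.finite_toSet.isBounded
  obtain ⟨x, hx, hxy⟩ := s.finite_toSet.isCompact.exists_infDist_eq_dist hs y
  refine ⟨x, hx, ?_⟩
  rw [← hxy]
  refine (Metric.infDist_le_hausdorffDist_of_mem (Finset.mem_coe.2 hy) hfin).trans ?_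
  rwa [Metric.hausdorffDist_comm]

theorem Model.mem_klMinimizers_iff [Fintype A] (θ : Model env k) {σ : stdSimplex ℝ A} {a : A}
    (ha : Function.support σ.1 = {a}) (ω : θ.Ω) :
    ω ∈ θ.klMinimizers σ ↔ ∀ ω', θ.KL a ω ≤ θ.KL a ω' := by
  have hzero : ∀ b, b ≠ a → σ.1 b = 0 := fun b hb =>
    Function.notMem_support.1 fun h => hb (by rw [ha] at h; exact h)
  have hone : σ.1 a = 1 := by
    rw [← σ.2.2]
    exact (Finset.sum_eq_single a (fun b _ hb => hzero b hb) (by simp)).symm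
  have hsum : ∀ ω, ∑ b, σ.1 b * θ.KL b ω = θ.KL a ω := fun ω => by
    rw [Finset.sum_eq_single a (fun b _ hb => by rw [hzero b hb, zero_mul]) (by simp), hone,
      one_mul]
  simp only [klMinimizers, hsum]
  rfl

/-! ### Choice of the policy, the prior and the radius -/

/-- A model with a uniformly strict Berk-Nash equilibrium at which it is locally dominant is
constrained locally robust. -/
theorem Model.isConstrainedLocallyRobust [Fintype A] {δ : ℝ} (hδ0 : 0 ≤ δ) (hδ1 : δ < 1) {α : ℝ}
    (hα : 1 < α) {F : Family env k} {θ : Model env k} (hθ : θ ∈ F.models) {σ : stdSimplex ℝ A}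
    (hσ : θ.IsUniformlyStrictBerkNash σ) (hdom : θ.IsLocallyDominant σ F) :
    θ.IsConstrainedLocallyRobust δ α F := by
  obtain ⟨-, ⟨a, ha⟩, hstrict⟩ := hσ
  obtain ⟨ε₀, hε₀, d, hd, hdom⟩ := hdom
  set M := θ.klMinimizers σ with hMdef
  have hMiff := θ.mem_klMinimizers_iff ha
  have hface : ∀ π ∈ θ.face M, θ.myopicOptimal π = {a} := fun π hπ => (hstrict π hπ).symm.trans ha
  obtain ⟨pol, hopt, c', hc', hpol'⟩ := θ.exists_optimalPolicy_near_face hδ0 hδ1 hface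
  -- Halving the threshold allows a non-strict inequality, which is what the mixture bound delivers.
  obtain ⟨c, hc, hpol⟩ : ∃ c > 0, ∀ π : θ.Belief, ∑ ω, Mᶜ.indicator π.1 ω ≤ c → pol π = a :=
    ⟨c' / 2, half_pos hc', fun π h => hpol' π (h.trans_lt (half_lt_self hc'))⟩
  have : Nonempty θ.Ω := θ.Ω_nonempty.to_subtype
  obtain ⟨ω₀, hω₀min⟩ := Finite.exists_min (θ.KL a)
  have hω₀ : ω₀ ∈ M := (hMiff ω₀).2 hω₀min
  have hMlt : ∀ ω ∉ M, θ.KL a ω₀ < θ.KL a ω := fun ω hω => by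
    rw [hMiff] at hω
    push Not at hω
    obtain ⟨ω', h⟩ := hω
    exact (hω₀min ω').trans_lt h
  -- Parameters outside `M` are strictly worse than `ω₀`, and lower semicontinuity passes this on to
  -- all competing parameters nearby. For `ω ∈ M` the radius is a dummy.
  have hlsc : ∀ ω : θ.Ω, ∃ e > 0, ω ∉ M → ∀ θ' ∈ F.models, ∀ ω' : θ'.Ω,
      dist (ω' : EuclideanSpace ℝ (Fin k)) ω < e → θ.KL a ω₀ < θ'.KL a ω' := by
    intro ω
    by_cases hω : ω ∈ M
    · exact ⟨1, one_pos, fun h => absurd hω h⟩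
    have hq : F.q a ω = θ.q a ω := (hθ.2 a ω ω.2).symm
    obtain ⟨e, he, hlt⟩ := F.exists_forall_lt_integral_log a (hθ.1 ω.2)
      (hq ▸ θ.q_pos a ω ω.2) (hq ▸ θ.integrable_log_ratio a ω.2) (c := θ.KL a ω₀)
      (by rw [hq, ← Model.KL_eq]; exact hMlt ω hω)
    refine ⟨e, he, fun _ θ' hθ' ω' hdist => ?_⟩
    have hq' : F.q a ω' = θ'.q a ω' := (hθ'.2 a ω' ω'.2).symm
    have := hlt ω' (hθ'.1 ω'.2) hdist (hq' ▸ θ'.q_pos a ω' ω'.2)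
      (hq' ▸ θ'.integrable_log_ratio a ω'.2)
    rwa [hq', ← Model.KL_eq] at this
  choose e he hlsc using hlsc
  obtain ⟨ε, ⟨hεlt, hεe⟩, hε⟩ : ∃ ε : ℝ, (ε < ε₀ ∧ ∀ ω, ε < e ω) ∧ 0 < ε := by
    have h1 : ∀ᶠ ε : ℝ in 𝓝[>] 0, ε < ε₀ ∧ ∀ ω, ε < e ω :=
      ((gt_mem_nhds hε₀).filter_mono nhdsWithin_le_nhds).and
        (eventually_all.2 fun ω => (gt_mem_nhds (he ω)).filter_mono nhdsWithin_le_nhds)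
    exact (h1.and self_mem_nhdsWithin).exists
  have hα0 : 0 < α := one_pos.trans hα
  have hαinv : α⁻¹ < 1 := inv_lt_one_of_one_lt₀ hα
  -- As `η` tends to zero the required budget tends to `α⁻¹ < 1`; this is where the switching
  -- threshold leaves room.
  obtain ⟨η, ⟨hη1, hbudget⟩, hη⟩ : ∃ η : ℝ, (η < 1 ∧ α⁻¹ + η / c < 1 - η) ∧ 0 < η := by
    have hcont : Tendsto (fun η : ℝ => α⁻¹ + η / c + η) (𝓝 0) (𝓝 (α⁻¹ + 0 / c + 0)) :=
      Continuous.tendsto (by fun_prop) 0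
    have h1 : ∀ᶠ η : ℝ in 𝓝[>] 0, η < 1 ∧ α⁻¹ + η / c < 1 - η := by
      refine Eventually.filter_mono nhdsWithin_le_nhds ?_
      filter_upwards [gt_mem_nhds one_pos, hcont.eventually (gt_mem_nhds
        (show α⁻¹ + 0 / c + 0 < 1 by simpa using hαinv))]
        with η h1 h2
      exact ⟨h1, by linarith⟩
    exact (h1.and self_mem_nhdsWithin).exists
  obtain ⟨π, hπfull, hπ⟩ := θ.exists_fullSupport_concentrated ω₀ hη hη1
  refine ⟨ε, hε, π, hπfull, pol, hopt, fun θ' hθ' hHaus π' _ _ pol' _ => ?_⟩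
  refine persistsAgainst_of_dichotomy hα0 π' pol' hc hη1 hπ hω₀ hMlt hbudget hpol fun ω' => ?_
  obtain ⟨ω, hω, hdist⟩ := exists_dist_le_of_hausdorffDist_le θ.Ω_nonempty hHaus ω'.2
  -- Every competing parameter lies within `ε` of some `ω` in the initial model: local dominance
  -- applies if `ω ∈ M`, lower semicontinuity otherwise.
  by_cases hωM : (⟨ω, hω⟩ : θ.Ω) ∈ M
  · have hthick : (ω' : EuclideanSpace ℝ (Fin k)) ∈
        F.Ωq ∩ Metric.thickening ε₀ (Subtype.val '' M) :=
      ⟨hθ'.1 ω'.2, Metric.mem_thickening_iff.2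
        ⟨ω, ⟨⟨ω, hω⟩, hωM, rfl⟩, hdist.trans_lt hεlt⟩⟩
    have hmom := hdom ω₀ hω₀ ω' hthick a (ha ▸ rfl)
    have hlog := θ.log_ratio_integrable_and_eq θ' a ω₀ ω'
    have hS := env.qStar_pos a
    refine (ae_eq_or_integral_log_neg (Q := env.QStar a)
      ((θ.q_measurable a ω₀ ω₀.2).fun_div (env.qStar_measurable a))
      ((θ'.q_measurable a ω' ω'.2).fun_div (env.qStar_measurable a))
      (fun y => div_pos (θ.q_pos a ω₀ ω₀.2 y) (hS y))
      (fun y => div_pos (θ'.q_pos a ω' ω'.2 y) (hS y)) hlog.1 hd ?_).imp id fun h => ?_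
    · simp_rw [div_div_div_cancel_right₀ (hS _).ne']
      rwa [← hθ'.2 a ω' ω'.2, ← hθ.2 a ω₀ ω₀.2] at hmom
    · rw [hlog.2] at h
      exact sub_neg.1 h
  · exact Or.inr (hlsc ⟨ω, hω⟩ hωM θ' hθ' ω' (hdist.trans_lt (hεe _)))

end ModelSwitching

theorem corollary3 {A : Type*} [Fintype A] {n k : ℕ}
    (env : ModelSwitching.Environment A n)
    (δ : ℝ) (hδ0 : 0 ≤ δ) (hδ1 : δ < 1) (α : ℝ) (hα : 1 < α)
    (F : ModelSwitching.Family env k)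
    (θ : ModelSwitching.Model env k) (hθ : θ ∈ F.models)
    (σ : stdSimplex ℝ A) (hσ : θ.IsUniformlyStrictBerkNash σ)
    (hdom : θ.IsLocallyDominant σ F) :
    θ.IsConstrainedLocallyRobust δ α F :=
  ModelSwitching.Model.isConstrainedLocallyRobust hδ0 hδ1 hα hθ hσ hdom
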